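/- Let $k$ be a field and let $R=\bigoplus_{j\ge 0}R_j$ be a standard graded $k$-algebra, that is, a commutative graded $k$-algebra with $R_0=k$, generated as a $k$-algebra by the finite-dimensional space $R_1$. Let $H_R(z)=\sum_{j\ge 0}\dim_k(R_j)\,z^j$ be its Hilbert series and let $h_R(z)\in\mathbb{Z}[z]$ be its $h$-polynomial, defined by $H_R(z)=h_R(z)/(1-z)^{\dim R}$. Let $a\in\mathbb{N}$ be the order of vanishing of $h_R(z)$ at $z=-1$, so that $h_R(z)=g(z)(1+z)^a$ with $g(z)\in\mathbb{Z}[z]$ and $g(-1)\ne 0$. For a standard graded $k$-algebra $A$ and a finitely generated graded $A$-module $M$, let $\beta^A_{i,j}(M)$ be the number of generators of degree $j$ of the $i$-th free module in a minimal graded free resolution of $M$ over $A$, and let $P^A_M(s,z)=\sum_{i,j}\beta^A_{i,j}(M)\,s^jz^i$. The algebra $R$ is *Koszul* if $k=R/R_{\ge 1}$ has a linear free resolution over $R$, i.e. one whose $i$-th free module is generated in degree $i$ for all $i$. A surjective morphism $\varphi\colon Q\to R$ of standard graded $k$-algebras is *Golod* if $\operatorname{Ker}\varphi\subseteq (Q_{\ge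 1})^2$ and $$P^R_k(s,z)=\frac{P^Q_k(s,z)}{1-z\,(P^Q_R(s,z)-1)}.$$ A standard graded $k$-algebra is a *complete intersection* if it is isomorphic, as a graded $k$-algebra, to the quotient of a standard graded polynomial ring $k[x_1,\dots,x_n]$ by an ideal generated by a regular sequence of homogeneous polynomials. The algebra $R$ has the *Backelin-Roos property* if there exists a surjective Golod morphism $Q\to R$ with $Q$ a standard graded $k$-algebra that is a complete intersection. If $R$ is Koszul, has the Backelin-Roos property, and is not a complete intersection, then $g(-1)<0$. -/

import Mathlib

universe u v w

/-- A standard graded algebra over a field `k`: a graded `k`-algebra `R = ⨁ R_j` with `R_0 = k`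
that is generated, as a `k`-algebra, by the finite dimensional `k`-vector space `R_1`. -/
structure IsStandardGraded {k : Type u} [Field k] {R : Type v} [CommRing R] [Algebra k R]
    (𝒜 : ℕ → Submodule k R) [GradedAlgebra 𝒜] : Prop where
  nontrivial : Nontrivial R
  degree_zero : 𝒜 0 = 1
  finite_degree_one : Module.Finite k (𝒜 1)
  generated : Algebra.adjoin k (𝒜 1 : Set R) = ⊤

/-- A minimal graded free resolution `⋯ → F₁ → F₀ → M → 0` of a graded `R`-module `M`, given in
homogeneous bases. Here `F_i = ⨁_q R(-deg i q)` has the basis `Pi.single q 1`, for `q` in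
`Fin (rank i)`, whose `q`-th member is homogeneous of degree `deg i q`. -/
structure MinimalGradedFreeResolution {k : Type u} [Field k] {R : Type v} [CommRing R]
    [Algebra k R] (𝒜 : ℕ → Submodule k R) [GradedAlgebra 𝒜]
    {M : Type w} [AddCommGroup M] [Module k M] [Module R M] (ℳ : ℕ → Submodule k M) where
  rank : ℕ → ℕ
  deg : (i : ℕ) → Fin (rank i) → ℕ
  d : (i : ℕ) → (Fin (rank (i + 1)) → R) →ₗ[R] (Fin (rank i) → R)
  aug : (Fin (rank 0) → R) →ₗ[R] M
  /-- The differentials preserve degrees. -/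
  d_homogeneous : ∀ (i : ℕ) (q : Fin (rank (i + 1))) (p : Fin (rank i)),
    d i (Pi.single q 1) p = 0 ∨
      ∃ n : ℕ, n + deg i p = deg (i + 1) q ∧ d i (Pi.single q 1) p ∈ 𝒜 n
  /-- The augmentation preserves degrees. -/
  aug_homogeneous : ∀ q : Fin (rank 0), aug (Pi.single q 1) ∈ ℳ (deg 0 q)
  aug_surjective : Function.Surjective aug
  exact_zero : Function.Exact (d 0) aug
  exact_succ : ∀ i : ℕ, Function.Exact (d (i + 1)) (d i)
  /-- Minimality: `d F_{i+1} ⊆ 𝔪 F_i`, with `𝔪` the homogeneous maximal ideal. -/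
  minimal : ∀ (i : ℕ) (q : Fin (rank (i + 1))) (p : Fin (rank i)),
    d i (Pi.single q 1) p ∈ (HomogeneousIdeal.irrelevant 𝒜).toIdeal

namespace MinimalGradedFreeResolution

variable {k : Type u} [Field k] {R : Type v} [CommRing R] [Algebra k R]
  {𝒜 : ℕ → Submodule k R} [GradedAlgebra 𝒜]
  {M : Type w} [AddCommGroup M] [Module k M] [Module R M] {ℳ : ℕ → Submodule k M}

/-- The graded Betti number `β_{i,j}`: the number of basis elements of `F_i` of degree `j`. -/
def betti (F : MinimalGradedFreeResolution 𝒜 ℳ) (i j : ℕ) : ℕ :=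
  (Finset.univ.filter fun q : Fin (F.rank i) => F.deg i q = j).card

/-- The Poincaré series `P(s, z) = ∑ β_{i,j} s^j z^i`, as an element of `ℤ⟦s⟧⟦z⟧`. -/
noncomputable def poincareSeries (F : MinimalGradedFreeResolution 𝒜 ℳ) :
    PowerSeries (PowerSeries ℤ) :=
  PowerSeries.mk fun i => PowerSeries.mk fun j => (F.betti i j : ℤ)

end MinimalGradedFreeResolution

/-- The residue field `R / R_{≥ 1}` of a graded algebra, as an `R`-module. -/
abbrev GradedResidueField {k : Type u} [Field k] {R : Type v} [CommRing R] [Algebra k R]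
    (𝒜 : ℕ → Submodule k R) [GradedAlgebra 𝒜] : Type v :=
  R ⧸ (HomogeneousIdeal.irrelevant 𝒜).toIdeal

/-- The grading of the residue field: the images of the homogeneous components of the algebra
(for a standard graded algebra, `k` in degree `0`). -/
def gradedResidueFieldGrading {k : Type u} [Field k] {R : Type v} [CommRing R] [Algebra k R]
    (𝒜 : ℕ → Submodule k R) [GradedAlgebra 𝒜] : ℕ → Submodule k (GradedResidueField 𝒜) :=
  fun j => (𝒜 j).map
    (Ideal.Quotient.mkₐ k (HomogeneousIdeal.irrelevant 𝒜).toIdeal).toLinearMap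

/-- `R` is Koszul: its residue field has a linear free resolution, that is, one in which `F_i` is
generated in degree `i` for every `i`. -/
def IsKoszul {k : Type u} [Field k] {R : Type v} [CommRing R] [Algebra k R]
    (𝒜 : ℕ → Submodule k R) [GradedAlgebra 𝒜] : Prop :=
  ∃ F : MinimalGradedFreeResolution 𝒜 (gradedResidueFieldGrading 𝒜),
    ∀ (i : ℕ) (q : Fin (F.rank i)), F.deg i q = i

/-- A minimal graded free resolution over `Q` of `R`, where `R` is a `Q`-module through a morphism
`φ : Q → R` of graded algebras. -/
abbrev RelativeResolution {k : Type u} [Field k] {Q : Type w} [CommRing Q] [Algebra k Q]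
    {R : Type v} [CommRing R] [Algebra k R] {𝒬 : ℕ → Submodule k Q} [GradedAlgebra 𝒬]
    {𝒜 : ℕ → Submodule k R} [GradedAlgebra 𝒜] (φ : 𝒬 →ₐᵍ[k] 𝒜) : Type (max v w) :=
  letI : Module Q R := Module.compHom R (φ.toAlgHom : Q →+* R)
  MinimalGradedFreeResolution 𝒬 𝒜

/-- The Poincaré series of `R` as a `Q`-module. -/
noncomputable def RelativeResolution.series {k : Type u} [Field k] {Q : Type w} [CommRing Q]
    [Algebra k Q] {R : Type v} [CommRing R] [Algebra k R] {𝒬 : ℕ → Submodule k Q}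
    [GradedAlgebra 𝒬] {𝒜 : ℕ → Submodule k R} [GradedAlgebra 𝒜] {φ : 𝒬 →ₐᵍ[k] 𝒜}
    (G : RelativeResolution φ) : PowerSeries (PowerSeries ℤ) :=
  letI : Module Q R := Module.compHom R (φ.toAlgHom : Q →+* R)
  MinimalGradedFreeResolution.poincareSeries G

/-- A surjective morphism `φ : Q → R` of standard graded algebras is Golod: its kernel lies in
`(Q_{≥ 1})²`, and `P^R_k = P^Q_k / (1 - z (P^Q_R - 1))` for the Poincaré series `P(s, z)`.
The denominator has constant term `1`, so it is a unit and the equality may be cleared of it.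
Minimal graded free resolutions exist and are unique up to isomorphism, so it does not matter from
which of them the three series are read off. -/
def IsGolod {k : Type u} [Field k] {Q : Type w} [CommRing Q] [Algebra k Q]
    {R : Type v} [CommRing R] [Algebra k R] {𝒬 : ℕ → Submodule k Q} [GradedAlgebra 𝒬]
    {𝒜 : ℕ → Submodule k R} [GradedAlgebra 𝒜] (φ : 𝒬 →ₐᵍ[k] 𝒜) : Prop :=
  Function.Surjective φ ∧
  RingHom.ker φ.toAlgHom ≤ (HomogeneousIdeal.irrelevant 𝒬).toIdeal ^ 2 ∧
  ∃ (K : MinimalGradedFreeResolution 𝒜 (gradedResidueFieldGrading 𝒜))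
    (L : MinimalGradedFreeResolution 𝒬 (gradedResidueFieldGrading 𝒬))
    (G : RelativeResolution φ),
    K.poincareSeries * (1 - PowerSeries.X * (G.series - 1)) = L.poincareSeries

/-- A standard graded algebra is a complete intersection if it is the quotient of a standard graded
polynomial ring by an ideal generated by a regular sequence of homogeneous polynomials. -/
def IsGradedCompleteIntersection {k : Type u} [Field k] {R : Type v} [CommRing R] [Algebra k R]
    (𝒜 : ℕ → Submodule k R) [GradedAlgebra 𝒜] : Prop :=
  ∃ (n : ℕ) (ψ : MvPolynomial (Fin n) k →ₐ[k] R) (rs : List (MvPolynomial (Fin n) k)),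
    (∀ i, ψ (MvPolynomial.X i) ∈ 𝒜 1) ∧
    Function.Surjective ψ ∧
    (∀ f ∈ rs, ∃ e : ℕ, f.IsHomogeneous e) ∧
    RingTheory.Sequence.IsRegular (MvPolynomial (Fin n) k) rs ∧
    RingHom.ker ψ = Ideal.ofList rs

/-- The Backelin-Roos property: there is a surjective Golod morphism `Q → R` from a standard graded
complete intersection `Q`. Up to isomorphism every standard graded `k`-algebra lives in the
universe of `k`. -/
def HasBackelinRoosProperty {k : Type u} [Field k] {R : Type v} [CommRing R] [Algebra k R]
    (𝒜 : ℕ → Submodule k R) [GradedAlgebra 𝒜] : Prop :=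
  ∃ (Q : Type u) (_ : CommRing Q) (_ : Algebra k Q) (𝒬 : ℕ → Submodule k Q)
    (_ : GradedAlgebra 𝒬) (φ : 𝒬 →ₐᵍ[k] 𝒜),
    IsStandardGraded 𝒬 ∧ IsGradedCompleteIntersection 𝒬 ∧ IsGolod φ

/-- The Hilbert series `H_R(z) = ∑ (dim_k R_j) z^j`. -/
noncomputable def gradedHilbertSeries {k : Type u} [Field k] {R : Type v} [CommRing R]
    [Algebra k R] (𝒜 : ℕ → Submodule k R) : PowerSeries ℤ :=
  PowerSeries.mk fun j => (Module.finrank k (𝒜 j) : ℤ)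

/-- `h` is the `h`-polynomial of `R`: `H_R(z) = h(z) / (1 - z)^d` where `d` is the Krull dimension
of `R`. There is exactly one such `h` for a standard graded algebra `R`. -/
def IsHPolynomial {k : Type u} [Field k] {R : Type v} [CommRing R] [Algebra k R]
    (𝒜 : ℕ → Submodule k R) (h : Polynomial ℤ) : Prop :=
  ∃ d : ℕ, ringKrullDim R = d ∧
    (h : PowerSeries ℤ) = gradedHilbertSeries 𝒜 * (1 - PowerSeries.X) ^ d

/-! Let `φ : Q → R` be Golod with `Q` a complete intersection, and let `G` be the minimal resolution
of `R` over `Q`. Write the Golod identity as `P (1 - Z) = L` with `Z = z (P^Q_R - 1)`. All three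
series have nonnegative coefficients, and Koszulness makes `P` diagonal, so off the diagonal `P₀₀
Z_{ij} ≤ -L_{ij} ≤ 0` and `Z` is diagonal too (`coeff_coeff_eq_zero_of_diagonal`). Hence `G_i` is
generated in degree `i + 1` for every `i ≥ 1`, and the Euler series `E(z) = P^Q_R(z, -1)` satisfies
`E(-z) = 1 - ∑_{i ≥ 1} (rank G_i) z^{i+1}` (`evalNegHom_eulerSeries`).

Counting dimensions along `G` gives `E · H_Q = H_R`. As `Q` is a complete intersection, `H_Q (1 -
z)^n = ∏ (1 - z^e)` with all `e > 0`. Therefore `E · ∏ (1 - z^e) · (1 - z)^d = g (1 + z)^a (1 -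
z)^n`. At `z = -r` with `0 < r < 1`, every factor other than `E` and `g` is positive, so `g(-r)` has
the sign of `E(-r)`. If `rank G_1 + rank G_2 ≥ 2`, then `E(-r) ≤ 1 - 2 r³ < 0` for `r` near `1`.
Letting `r → 1` gives `g(-1) ≤ 0`, and `g(-1) ≠ 0` makes this strict
(`eval_neg_one_nonpos_of_mul_prod_eq`). If `rank G_1 + rank G_2 < 2`, then `φ` is bijective or its
kernel is generated by one homogeneous nonzerodivisor, and `R` would be a complete intersection
(`two_le_rank_one_add_rank_two`).

Koszulness and the Golod identity may refer to different resolutions of `k` over `R`. Linearity is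
carried from one to the other by the invariance of ranks (`rank_eq`, through Schanuel's lemma) and
the equality of the Euler series (`deg_eq_of_linear`). -/

/-! ### Graded pieces of free modules. -/

section GradedPieces

variable {k : Type u} [Field k] {R : Type v} [CommRing R] [Algebra k R]
  (𝒜 : ℕ → Submodule k R)

/-- The degree `j` piece of the shifted algebra `R(-d)`. -/
def shiftedPiece (d j : ℕ) : Submodule k R := if d ≤ j then 𝒜 (j - d) else ⊥

/-- The degree `j` piece of the graded free module `⨁_q R(-deg q)`. -/
def freePiece {r : ℕ} (deg : Fin r → ℕ) (j : ℕ) : Submodule k (Fin r → R) :=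
  Submodule.pi Set.univ fun q => shiftedPiece 𝒜 (deg q) j

variable {𝒜}

theorem shiftedPiece_of_le {d j : ℕ} (h : d ≤ j) : shiftedPiece 𝒜 d j = 𝒜 (j - d) := if_pos h

theorem shiftedPiece_of_not_le {d j : ℕ} (h : ¬ d ≤ j) : shiftedPiece 𝒜 d j = ⊥ := if_neg h

theorem mem_freePiece {r : ℕ} {deg : Fin r → ℕ} {j : ℕ} {x : Fin r → R} :
    x ∈ freePiece 𝒜 deg j ↔ ∀ q, x q ∈ shiftedPiece 𝒜 (deg q) j := by
  simp [freePiece, Submodule.mem_pi]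

theorem mem_shiftedPiece_of_mem {n d j : ℕ} (h : n + d = j) {x : R} (hx : x ∈ 𝒜 n) :
    x ∈ shiftedPiece 𝒜 d j := by
  subst h
  simpa [shiftedPiece] using hx

section Map

variable {N : Type w} [AddCommGroup N] [Module k N] [Module R N] {𝒩 : ℕ → Submodule k N}

theorem linearMap_apply_eq_sum {r : ℕ} (f : (Fin r → R) →ₗ[R] N) (x : Fin r → R) :
    f x = ∑ q, x q • f (Pi.single q 1) := by
  conv_lhs => rw [← Finset.univ_sum_single x, map_sum]
  refine Finset.sum_congr rfl fun q _ => ?_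
  rw [← map_smul, ← Pi.single_smul, smul_eq_mul, mul_one]

theorem map_mem_of_mem_freePiece (hsmul : ∀ n m, ∀ a ∈ 𝒜 n, ∀ x ∈ 𝒩 m, a • x ∈ 𝒩 (n + m))
    {r : ℕ} {deg : Fin r → ℕ} (f : (Fin r → R) →ₗ[R] N)
    (hf : ∀ q, f (Pi.single q 1) ∈ 𝒩 (deg q)) {j : ℕ} {x : Fin r → R}
    (hx : x ∈ freePiece 𝒜 deg j) : f x ∈ 𝒩 j := by
  rw [linearMap_apply_eq_sum]
  refine Submodule.sum_mem _ fun q _ => ?_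
  have := mem_freePiece.1 hx q
  unfold shiftedPiece at this
  split_ifs at this with h
  · have h2 := hsmul _ _ _ this _ (hf q)
    rwa [Nat.sub_add_cancel h] at h2
  · have : x q = 0 := by simpa using this
    simp [this]

end Map

instance finite_shiftedPiece [∀ j, Module.Finite k (𝒜 j)] (d j : ℕ) :
    Module.Finite k (shiftedPiece 𝒜 d j) := by
  by_cases h : d ≤ j
  · rw [shiftedPiece_of_le h]; infer_instance
  · rw [shiftedPiece_of_not_le h]; infer_instance

theorem finrank_freePiece [∀ j, Module.Finite k (𝒜 j)] {r : ℕ} (deg : Fin r → ℕ) (j : ℕ) :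
    Module.finrank k (freePiece 𝒜 deg j) =
      ∑ q, if deg q ≤ j then Module.finrank k (𝒜 (j - deg q)) else 0 := by
  have e : freePiece 𝒜 deg j ≃ₗ[k] ((q : Fin r) → shiftedPiece 𝒜 (deg q) j) :=
    { toFun := fun x q => ⟨x.1 q, mem_freePiece.1 x.2 q⟩
      invFun := fun y => ⟨fun q => y q, mem_freePiece.2 fun q => (y q).2⟩
      map_add' := fun _ _ => rfl
      map_smul' := fun _ _ => rfl
      left_inv := fun _ => rfl
      right_inv := fun _ => rfl }
  rw [e.finrank_eq, Module.finrank_pi_fintype]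
  refine Finset.sum_congr rfl fun q _ => ?_
  split_ifs with h
  · rw [shiftedPiece_of_le h]
  · rw [shiftedPiece_of_not_le h, finrank_bot]

theorem finite_freePiece [∀ j, Module.Finite k (𝒜 j)] {r : ℕ} (deg : Fin r → ℕ) (j : ℕ) :
    Module.Finite k (freePiece 𝒜 deg j) := by
  let f : freePiece 𝒜 deg j →ₗ[k] ((q : Fin r) → shiftedPiece 𝒜 (deg q) j) :=
    { toFun := fun x q => ⟨x.1 q, mem_freePiece.1 x.2 q⟩
      map_add' := fun _ _ => rfl
      map_smul' := fun _ _ => rfl }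
  refine Module.Finite.of_injective f fun x y h => ?_
  ext q
  exact congrArg Subtype.val (congrFun h q)

variable (𝒜)

variable [GradedAlgebra 𝒜]

/-- The projection of `R(-d)` onto its degree `j` piece. -/
def shiftedComponent (d j : ℕ) : R →ₗ[k] R :=
  if d ≤ j then GradedAlgebra.proj 𝒜 (j - d) else 0

/-- The projection of `⨁_q R(-deg q)` onto its degree `j` piece. -/
def freeComponent {r : ℕ} (deg : Fin r → ℕ) (j : ℕ) : (Fin r → R) →ₗ[k] (Fin r → R) :=
  LinearMap.pi fun q => shiftedComponent 𝒜 (deg q) j ∘ₗ LinearMap.proj q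

/-- For each degree there is an additive map that is the identity on the piece of this degree and
vanishes on all others. -/
def HasGradedProjections {N : Type w} [AddCommGroup N] [Module k N] (𝒩 : ℕ → Submodule k N) :
    Prop :=
  ∀ j, ∃ π : N →+ N, (∀ n ∈ 𝒩 j, π n = n) ∧ ∀ i, i ≠ j → ∀ n ∈ 𝒩 i, π n = 0

variable {𝒜}

theorem shiftedComponent_mem (d j : ℕ) (x : R) :
    shiftedComponent 𝒜 d j x ∈ shiftedPiece 𝒜 d j := by
  unfold shiftedComponent shiftedPiece
  split_ifs
  · rw [GradedAlgebra.proj_apply]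
    exact SetLike.coe_mem _
  · simp

theorem freeComponent_mem {r : ℕ} (deg : Fin r → ℕ) (j : ℕ) (x : Fin r → R) :
    freeComponent 𝒜 deg j x ∈ freePiece 𝒜 deg j :=
  mem_freePiece.2 fun q => shiftedComponent_mem (deg q) j (x q)

theorem shiftedComponent_of_mem {d j : ℕ} {x : R} (hx : x ∈ shiftedPiece 𝒜 d j) :
    shiftedComponent 𝒜 d j x = x := by
  unfold shiftedComponent
  unfold shiftedPiece at hx
  split_ifs at hx ⊢ with h
  · rw [GradedAlgebra.proj_apply]
    exact DirectSum.decompose_of_mem_same _ hx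
  · simpa using hx.symm

theorem shiftedComponent_of_mem_ne {d i j : ℕ} (hij : i ≠ j) {x : R}
    (hx : x ∈ shiftedPiece 𝒜 d i) : shiftedComponent 𝒜 d j x = 0 := by
  unfold shiftedComponent
  unfold shiftedPiece at hx
  split_ifs at hx ⊢ with h h'
  · rw [GradedAlgebra.proj_apply]
    exact DirectSum.decompose_of_mem_ne _ hx (by omega)
  · have : x = 0 := by simpa using hx
    simp [this]
  · rfl
  · rfl

theorem freePiece_hasGradedProjections {r : ℕ} (deg : Fin r → ℕ) :
    HasGradedProjections (freePiece 𝒜 deg) := by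
  intro j
  refine ⟨(freeComponent 𝒜 deg j).toAddMonoidHom, fun n hn => ?_, fun i hij n hn => ?_⟩
  · ext q
    exact shiftedComponent_of_mem (mem_freePiece.1 hn q)
  · ext q
    exact shiftedComponent_of_mem_ne hij (mem_freePiece.1 hn q)

theorem hasGradedProjections_self : HasGradedProjections 𝒜 := by
  intro j
  refine ⟨(GradedAlgebra.proj 𝒜 j).toAddMonoidHom, fun n hn => ?_, fun i hij n hn => ?_⟩
  · exact DirectSum.decompose_of_mem_same _ hn
  · exact DirectSum.decompose_of_mem_ne _ hn hij

theorem freePiece_smul_mem {r : ℕ} (deg : Fin r → ℕ) (n m : ℕ) (a : R) (ha : a ∈ 𝒜 n)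
    (x : Fin r → R) (hx : x ∈ freePiece 𝒜 deg m) : a • x ∈ freePiece 𝒜 deg (n + m) := by
  rw [mem_freePiece] at hx ⊢
  intro q
  have := hx q
  by_cases h : deg q ≤ m
  · rw [shiftedPiece_of_le h] at this
    exact mem_shiftedPiece_of_mem (by omega) (SetLike.mul_mem_graded ha this)
  · rw [shiftedPiece_of_not_le h, Submodule.mem_bot] at this
    simp [this]

section Map

variable {N : Type w} [AddCommGroup N] [Module k N] [Module R N] {𝒩 : ℕ → Submodule k N}

theorem gradedProjection_smul (hsmul : ∀ n m, ∀ a ∈ 𝒜 n, ∀ x ∈ 𝒩 m, a • x ∈ 𝒩 (n + m))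
    {j : ℕ} {π : N →+ N} (h1 : ∀ n ∈ 𝒩 j, π n = n) (h2 : ∀ i, i ≠ j → ∀ n ∈ 𝒩 i, π n = 0)
    {d : ℕ} {y : N} (hy : y ∈ 𝒩 d) (a : R) :
    π (a • y) = shiftedComponent 𝒜 d j a • y := by
  induction a using DirectSum.Decomposition.inductionOn 𝒜 with
  | zero => simp
  | @homogeneous n a =>
    have hay := hsmul _ _ _ a.2 _ hy
    by_cases hj : n + d = j
    · subst hj
      rw [h1 _ hay, shiftedComponent_of_mem (mem_shiftedPiece_of_mem rfl a.2)]
    · rw [h2 _ hj _ hay, shiftedComponent_of_mem_ne hj (mem_shiftedPiece_of_mem rfl a.2), zero_smul]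
  | add a b ha hb => rw [add_smul, map_add, ha, hb, map_add, add_smul]

/-- A homogeneous element in the image of a degree-preserving map has a preimage of the same degree:
the other components of any preimage can be dropped. This turns exactness into exactness in each
degree. -/
theorem map_freeComponent (hsmul : ∀ n m, ∀ a ∈ 𝒜 n, ∀ x ∈ 𝒩 m, a • x ∈ 𝒩 (n + m))
    (hproj : HasGradedProjections 𝒩) {r : ℕ} {deg : Fin r → ℕ} (f : (Fin r → R) →ₗ[R] N)
    (hf : ∀ q, f (Pi.single q 1) ∈ 𝒩 (deg q)) {j : ℕ} {x : Fin r → R} (hx : f x ∈ 𝒩 j) :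
    f (freeComponent 𝒜 deg j x) = f x := by
  obtain ⟨π, h1, h2⟩ := hproj j
  rw [← h1 _ hx, linearMap_apply_eq_sum f x, linearMap_apply_eq_sum f (freeComponent 𝒜 deg j x),
    map_sum]
  exact Finset.sum_congr rfl fun q _ => (gradedProjection_smul hsmul h1 h2 (hf q) (x q)).symm

end Map

theorem coe_zero_mem_irrelevant {x : R} (h0 : x ∈ 𝒜 0)
    (hx : x ∈ (HomogeneousIdeal.irrelevant 𝒜).toIdeal) : x = 0 := by
  have := (HomogeneousIdeal.mem_irrelevant_iff 𝒜 x).1 hx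
  rw [GradedRing.proj_apply, DirectSum.decompose_of_mem_same _ h0] at this
  exact this

end GradedPieces

/-! ### Euler characteristic of a minimal graded resolution. -/

namespace MinimalGradedFreeResolution

variable {k : Type u} [Field k] {R : Type v} [CommRing R] [Algebra k R]
  {𝒜 : ℕ → Submodule k R} [GradedAlgebra 𝒜]
  {M : Type w} [AddCommGroup M] [Module k M] [Module R M] {ℳ : ℕ → Submodule k M}
  (F : MinimalGradedFreeResolution 𝒜 ℳ)

/-- The value `P(s, -1)` of the Poincaré series. -/
noncomputable def eulerSeries : PowerSeries ℤ :=
  PowerSeries.mk fun j => ∑ i ∈ Finset.range (j + 1), (-1 : ℤ) ^ i * F.betti i j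

theorem d_single_mem (i : ℕ) (q : Fin (F.rank (i + 1))) :
    F.d i (Pi.single q 1) ∈ freePiece 𝒜 (F.deg i) (F.deg (i + 1) q) := by
  rw [mem_freePiece]
  intro p
  rcases F.d_homogeneous i q p with h | ⟨n, hn, h⟩
  · rw [h]; exact zero_mem _
  · exact mem_shiftedPiece_of_mem hn h

theorem d_mem_irrelevant (i : ℕ) (x : Fin (F.rank (i + 1)) → R) (p : Fin (F.rank i)) :
    F.d i x p ∈ (HomogeneousIdeal.irrelevant 𝒜).toIdeal := by
  rw [linearMap_apply_eq_sum, Finset.sum_apply]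
  exact Ideal.sum_mem _ fun q _ => Ideal.mul_mem_left _ _ (F.minimal i q p)

theorem one_notMem_irrelevant [Nontrivial R] :
    (1 : R) ∉ (HomogeneousIdeal.irrelevant 𝒜).toIdeal := fun h =>
  one_ne_zero (coe_zero_mem_irrelevant (SetLike.GradedOne.one_mem (A := 𝒜)) h)

/-- A basis vector killed by the differential would be a boundary, so its coordinate `1` would lie
in the irrelevant ideal. -/
theorem d_single_ne_zero [Nontrivial R] (i : ℕ) (q : Fin (F.rank (i + 1))) :
    F.d i (Pi.single q 1) ≠ 0 := by
  intro h
  obtain ⟨y, hy⟩ := (F.exact_succ i _).1 h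
  have := F.d_mem_irrelevant (i + 1) y q
  rw [hy, Pi.single_eq_same] at this
  exact one_notMem_irrelevant this

theorem exists_deg_lt [Nontrivial R] (i : ℕ) (q : Fin (F.rank (i + 1))) :
    ∃ p, F.deg i p < F.deg (i + 1) q := by
  obtain ⟨p, hp⟩ := Function.ne_iff.1 (F.d_single_ne_zero i q)
  refine ⟨p, ?_⟩
  rcases F.d_homogeneous i q p with h | ⟨n, hn, h⟩
  · exact absurd h hp
  · rcases Nat.eq_zero_or_pos n with rfl | hn'
    · exact absurd (coe_zero_mem_irrelevant h (F.minimal i q p)) hp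
    · omega

theorem le_deg [Nontrivial R] (i : ℕ) (q : Fin (F.rank i)) : i ≤ F.deg i q := by
  induction i with
  | zero => exact Nat.zero_le _
  | succ i ih =>
    obtain ⟨p, hp⟩ := F.exists_deg_lt i q
    have := ih p
    omega

theorem betti_eq_zero_of_lt [Nontrivial R] {i j : ℕ} (h : j < i) : F.betti i j = 0 := by
  rw [betti, Finset.card_eq_zero, Finset.filter_eq_empty_iff]
  intro q _ hq
  have := F.le_deg i q
  omega

theorem freePiece_eq_bot_of_lt [Nontrivial R] {i j : ℕ} (h : j < i) :
    freePiece 𝒜 (F.deg i) j = ⊥ := by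
  rw [eq_bot_iff]
  intro x hx
  rw [Submodule.mem_bot]
  ext q
  have h1 := mem_freePiece.1 hx q
  have := F.le_deg i q
  rw [shiftedPiece, if_neg (by omega)] at h1
  simpa using h1

theorem d_mem_freePiece {i j : ℕ} {x : Fin (F.rank (i + 1)) → R}
    (hx : x ∈ freePiece 𝒜 (F.deg (i + 1)) j) : F.d i x ∈ freePiece 𝒜 (F.deg i) j :=
  map_mem_of_mem_freePiece (freePiece_smul_mem _) (F.d i) (F.d_single_mem i) hx

theorem exists_mem_freePiece_d_eq {i j : ℕ} {x : Fin (F.rank (i + 1)) → R}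
    (hx : F.d i x ∈ freePiece 𝒜 (F.deg i) j) :
    ∃ y ∈ freePiece 𝒜 (F.deg (i + 1)) j, F.d i y = F.d i x :=
  ⟨_, freeComponent_mem _ _ x, map_freeComponent (freePiece_smul_mem _)
    (freePiece_hasGradedProjections _) (F.d i) (F.d_single_mem i) hx⟩

/-- The differential in degree `j`. -/
def dPiece (i j : ℕ) : freePiece 𝒜 (F.deg (i + 1)) j →ₗ[k] freePiece 𝒜 (F.deg i) j :=
  ((F.d i).restrictScalars k).restrict fun _ hx => F.d_mem_freePiece hx

/-- Rank-nullity for the differential in degree `j`, its image being the next kernel by exactness.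
-/
theorem finrank_freePiece_succ [∀ j, Module.Finite k (𝒜 j)] (i j : ℕ) :
    Module.finrank k (freePiece 𝒜 (F.deg (i + 2)) j) =
      Module.finrank k (LinearMap.ker (F.dPiece (i + 1) j)) +
        Module.finrank k (LinearMap.ker (F.dPiece i j)) := by
  have := finite_freePiece (𝒜 := 𝒜) (F.deg (i + 2)) j
  have h : LinearMap.ker (F.dPiece i j) = LinearMap.range (F.dPiece (i + 1) j) := by
    ext x
    constructor
    · intro hx
      obtain ⟨y, hy⟩ := (F.exact_succ i _).1 (congrArg Subtype.val (LinearMap.mem_ker.1 hx))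
      obtain ⟨z, hz, hzy⟩ := F.exists_mem_freePiece_d_eq (by rw [hy]; exact x.2)
      exact ⟨⟨z, hz⟩, Subtype.ext (hzy.trans hy)⟩
    · rintro ⟨y, rfl⟩
      exact LinearMap.mem_ker.2 (Subtype.ext ((F.exact_succ i _).2 ⟨y.1, rfl⟩))
  rw [h]
  exact (LinearMap.finrank_range_add_finrank_ker _).symm.trans (add_comm _ _)

theorem finrank_freePiece_eq_sum_betti [∀ j, Module.Finite k (𝒜 j)] (i j : ℕ) :
    Module.finrank k (freePiece 𝒜 (F.deg i) j) =
      ∑ p ∈ Finset.HasAntidiagonal.antidiagonal j, F.betti i p.1 * Module.finrank k (𝒜 p.2) := by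
  rw [finrank_freePiece, Finset.Nat.sum_antidiagonal_eq_sum_range_succ
    (fun a b => F.betti i a * Module.finrank k (𝒜 b))]
  simp only [betti, Finset.card_filter, Finset.sum_mul]
  rw [Finset.sum_comm]
  refine Finset.sum_congr rfl fun q _ => ?_
  simp only [ite_mul, one_mul, zero_mul]
  rw [Finset.sum_ite_eq]
  simp

variable [IsScalarTower k R M]

/-- The augmentation in degree `j`. -/
def augPiece (hsmul : ∀ n m, ∀ a ∈ 𝒜 n, ∀ x ∈ ℳ m, a • x ∈ ℳ (n + m)) (j : ℕ) :
    freePiece 𝒜 (F.deg 0) j →ₗ[k] ℳ j :=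
  (F.aug.restrictScalars k).restrict fun _ hx =>
    map_mem_of_mem_freePiece hsmul F.aug F.aug_homogeneous hx

theorem finrank_freePiece_one [∀ j, Module.Finite k (𝒜 j)]
    (hsmul : ∀ n m, ∀ a ∈ 𝒜 n, ∀ x ∈ ℳ m, a • x ∈ ℳ (n + m)) (j : ℕ) :
    Module.finrank k (freePiece 𝒜 (F.deg 1) j) =
      Module.finrank k (LinearMap.ker (F.dPiece 0 j)) +
        Module.finrank k (LinearMap.ker (F.augPiece hsmul j)) := by
  have := finite_freePiece (𝒜 := 𝒜) (F.deg 1) j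
  have h : LinearMap.ker (F.augPiece hsmul j) = LinearMap.range (F.dPiece 0 j) := by
    ext x
    constructor
    · intro hx
      obtain ⟨y, hy⟩ := (F.exact_zero _).1 (congrArg Subtype.val (LinearMap.mem_ker.1 hx))
      obtain ⟨z, hz, hzy⟩ := F.exists_mem_freePiece_d_eq (by rw [hy]; exact x.2)
      exact ⟨⟨z, hz⟩, Subtype.ext (hzy.trans hy)⟩
    · rintro ⟨y, rfl⟩
      exact LinearMap.mem_ker.2 (Subtype.ext ((F.exact_zero _).2 ⟨y.1, rfl⟩))
  rw [h]
  exact (LinearMap.finrank_range_add_finrank_ker _).symm.trans (add_comm _ _)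

theorem finrank_freePiece_zero [∀ j, Module.Finite k (𝒜 j)]
    (hsmul : ∀ n m, ∀ a ∈ 𝒜 n, ∀ x ∈ ℳ m, a • x ∈ ℳ (n + m))
    (hproj : HasGradedProjections ℳ) (j : ℕ) :
    Module.finrank k (freePiece 𝒜 (F.deg 0) j) =
      Module.finrank k (LinearMap.ker (F.augPiece hsmul j)) + Module.finrank k (ℳ j) := by
  have := finite_freePiece (𝒜 := 𝒜) (F.deg 0) j
  have h : LinearMap.range (F.augPiece hsmul j) = ⊤ := by
    rw [LinearMap.range_eq_top]
    intro x
    obtain ⟨y, hy⟩ := F.aug_surjective x.1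
    exact ⟨⟨_, freeComponent_mem _ j y⟩, Subtype.ext <|
      (map_freeComponent hsmul hproj F.aug F.aug_homogeneous (hy ▸ x.2)).trans hy⟩
  rw [← LinearMap.finrank_range_add_finrank_ker (F.augPiece hsmul j), h, finrank_top, add_comm]

theorem sum_neg_one_pow_finrank_freePiece [Nontrivial R] [∀ j, Module.Finite k (𝒜 j)]
    (hsmul : ∀ n m, ∀ a ∈ 𝒜 n, ∀ x ∈ ℳ m, a • x ∈ ℳ (n + m))
    (hproj : HasGradedProjections ℳ) (j : ℕ) :
    ∑ i ∈ Finset.range (j + 1), (-1 : ℤ) ^ i * Module.finrank k (freePiece 𝒜 (F.deg i) j) =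
      Module.finrank k (ℳ j) := by
  -- The truncated alternating sum telescopes, leaving only the last kernel as error term; at `N =
  -- j` that kernel lies in a zero space.
  have key : ∀ N, ∑ i ∈ Finset.range (N + 2),
      (-1 : ℤ) ^ i * Module.finrank k (freePiece 𝒜 (F.deg i) j) =
      Module.finrank k (ℳ j) +
        (-1 : ℤ) ^ (N + 1) * Module.finrank k (LinearMap.ker (F.dPiece N j)) := by
    intro N
    induction N with
    | zero =>
      rw [Finset.sum_range_succ, Finset.sum_range_one, F.finrank_freePiece_zero hsmul hproj,
        F.finrank_freePiece_one hsmul]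
      push_cast; ring
    | succ N ih =>
      rw [Finset.sum_range_succ, ih, F.finrank_freePiece_succ]
      push_cast; ring
  have h1 := key j
  have h2 : Module.finrank k (freePiece 𝒜 (F.deg (j + 1)) j) = 0 := by
    rw [F.freePiece_eq_bot_of_lt (Nat.lt_succ_self j)]
    exact finrank_bot k _
  have h3 : Module.finrank k (LinearMap.ker (F.dPiece j j)) = 0 := by
    have := finite_freePiece (𝒜 := 𝒜) (F.deg (j + 1)) j
    have := Submodule.finrank_le (LinearMap.ker (F.dPiece j j))
    omega
  rw [Finset.sum_range_succ, h2, h3] at h1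
  simpa using h1

theorem eulerSeries_mul_gradedHilbertSeries [Nontrivial R] [∀ j, Module.Finite k (𝒜 j)]
    (hsmul : ∀ n m, ∀ a ∈ 𝒜 n, ∀ x ∈ ℳ m, a • x ∈ ℳ (n + m))
    (hproj : HasGradedProjections ℳ) :
    F.eulerSeries * gradedHilbertSeries 𝒜 =
      PowerSeries.mk fun j => (Module.finrank k (ℳ j) : ℤ) := by
  ext j
  rw [PowerSeries.coeff_mul, PowerSeries.coeff_mk,
    ← F.sum_neg_one_pow_finrank_freePiece hsmul hproj j]
  simp_rw [F.finrank_freePiece_eq_sum_betti, eulerSeries, gradedHilbertSeries,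
    PowerSeries.coeff_mk, Nat.cast_sum, Finset.mul_sum]
  rw [Finset.sum_comm (s := Finset.range (j + 1))]
  refine Finset.sum_congr rfl fun p hp => ?_
  have hp' : p.1 ≤ j := by
    rw [Finset.HasAntidiagonal.mem_antidiagonal] at hp; omega
  rw [Finset.sum_mul, ← Finset.sum_subset (Finset.range_mono (Nat.succ_le_succ hp'))]
  · exact Finset.sum_congr rfl fun i _ => by push_cast; ring
  · intro i _ hi
    rw [F.betti_eq_zero_of_lt (by simpa using hi)]
    simp

end MinimalGradedFreeResolution

/-! ### Schanuel's lemma and stable isomorphism. -/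

section Schanuel

variable {R : Type v} [CommRing R]

/-- Schanuel's lemma. -/
theorem exists_ker_prod_equiv {P P' N : Type*} [AddCommGroup P] [AddCommGroup P']
    [AddCommGroup N] [Module R P] [Module R P'] [Module R N] [Module.Projective R P]
    [Module.Projective R P'] (p : P →ₗ[R] N) (p' : P' →ₗ[R] N) (hp : Function.Surjective p)
    (hp' : Function.Surjective p') :
    Nonempty ((LinearMap.ker p × P') ≃ₗ[R] (LinearMap.ker p' × P)) := by
  obtain ⟨σ, hσ⟩ := Module.projective_lifting_property p p' hp
  obtain ⟨τ, hτ⟩ := Module.projective_lifting_property p' p hp'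
  have hσ' : ∀ y, p (σ y) = p' y := LinearMap.congr_fun hσ
  have hτ' : ∀ x, p' (τ x) = p x := LinearMap.congr_fun hτ
  -- Both sides parametrize the fibre product of `P` and `P'` over `N`: `(x, y)` gives the point `(x
  -- + σ y, y)`, which is then split using `τ` instead of `σ`.
  refine ⟨{ toFun := fun z => (⟨z.2 - τ (z.1 + σ z.2), ?_⟩, z.1 + σ z.2)
            invFun := fun z => (⟨z.2 - σ (z.1 + τ z.2), ?_⟩, z.1 + τ z.2)
            map_add' := ?_
            map_smul' := ?_
            left_inv := ?_
            right_inv := ?_ }⟩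
  · rw [LinearMap.mem_ker, map_sub, hτ', map_add, hσ', LinearMap.mem_ker.1 z.1.2]
    simp
  · intro x y
    ext <;> simp <;> abel
  · intro c x
    ext <;> simp [smul_sub]
  · rw [LinearMap.mem_ker, map_sub, hσ', map_add, hτ', LinearMap.mem_ker.1 z.1.2]
    simp
  · intro x
    ext <;> simp
  · intro x
    ext <;> simp

/-- Lifts `σ`, `τ` between the two covers satisfy `σ τ ≡ id` modulo `ker p`, hence modulo `I`. So
`τ` becomes injective after base change to `R ⧸ I`, where ranks can be compared. -/
theorem finrank_le_of_ker_le {P P' N : Type*} [AddCommGroup P] [AddCommGroup P']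
    [AddCommGroup N] [Module R P] [Module R P'] [Module R N] [Module.Free R P]
    [Module.Free R P'] [Module.Finite R P] [Module.Finite R P'] {I : Ideal R} (hI : I ≠ ⊤)
    (p : P →ₗ[R] N) (p' : P' →ₗ[R] N) (hp : Function.Surjective p)
    (hp' : Function.Surjective p') (hker : LinearMap.ker p ≤ I • ⊤) :
    Module.finrank R P ≤ Module.finrank R P' := by
  have : Nontrivial (R ⧸ I) := Ideal.Quotient.nontrivial_iff.2 hI
  have : Nontrivial R := (Ideal.Quotient.mk_surjective (I := I)).nontrivial
  obtain ⟨σ, hσ⟩ := Module.projective_lifting_property p p' hp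
  obtain ⟨τ, hτ⟩ := Module.projective_lifting_property p' p hp'
  have hcomp : ∀ x, σ (τ x) - x ∈ (I • ⊤ : Submodule R P) := fun x => hker <| by
    have h1 : p (σ (τ x)) = p' (τ x) := LinearMap.congr_fun hσ _
    have h2 : p' (τ x) = p x := LinearMap.congr_fun hτ _
    rw [LinearMap.mem_ker, map_sub, h1, h2, sub_self]
  have hzero : ∀ z ∈ (I • ⊤ : Submodule R P), (1 : R ⧸ I) ⊗ₜ[R] z = 0 := by
    intro z hz
    induction hz using Submodule.smul_induction_on' with
    | smul r hr n _ =>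
      rw [← TensorProduct.smul_tmul, Algebra.smul_def, Ideal.Quotient.algebraMap_eq,
        Ideal.Quotient.eq_zero_iff_mem.2 hr, zero_mul, TensorProduct.zero_tmul]
    | add x _ y _ hx hy => rw [TensorProduct.tmul_add, hx, hy, add_zero]
  have hid : (σ.baseChange (R ⧸ I)) ∘ₗ (τ.baseChange (R ⧸ I)) = LinearMap.id := by
    ext x
    have h := hzero _ (hcomp x)
    rw [TensorProduct.tmul_sub, sub_eq_zero] at h
    simpa using h
  rw [← Module.finrank_baseChange (R := R ⧸ I) (M' := P),
    ← Module.finrank_baseChange (R := R ⧸ I) (M' := P')]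
  exact LinearMap.finrank_le_finrank_of_injective (f := τ.baseChange (R ⧸ I))
    (Function.LeftInverse.injective (g := σ.baseChange (R ⧸ I)) (LinearMap.congr_fun hid))

/-- Two modules that become isomorphic after adding the same finite free module to both. -/
def StablyIsomorphic (R : Type v) [CommRing R] (M M' : Type*) [AddCommGroup M] [AddCommGroup M']
    [Module R M] [Module R M'] : Prop :=
  ∃ (ι : Type) (_ : Finite ι), Nonempty ((M × (ι → R)) ≃ₗ[R] (M' × (ι → R)))

theorem mem_smul_top_of_forall_mem {ι : Type*} [Finite ι] {I : Ideal R} {x : ι → R}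
    (h : ∀ i, x i ∈ I) : x ∈ (I • ⊤ : Submodule R (ι → R)) := by
  classical
  have := Fintype.ofFinite ι
  rw [← Finset.univ_sum_single x]
  refine Submodule.sum_mem _ fun i _ => ?_
  have : Pi.single i (x i) = x i • (Pi.single i 1 : ι → R) := by
    rw [← Pi.single_smul, smul_eq_mul, mul_one]
  rw [this]
  exact Submodule.smul_mem_smul (h i) Submodule.mem_top

/-- The induction step for uniqueness of minimal resolutions. Adding `R^ι` to a cover with the
identity map does not change its kernel, so both covers can be compared over one module; kernels
inside `I` times the cover force equal ranks, and Schanuel's lemma relates the kernels. -/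
theorem StablyIsomorphic.rank_eq_and_ker {M M' : Type*} [AddCommGroup M] [AddCommGroup M']
    [Module R M] [Module R M'] (h : StablyIsomorphic R M M') {I : Ideal R} (hI : I ≠ ⊤)
    {r r' : ℕ} (p : (Fin r → R) →ₗ[R] M) (p' : (Fin r' → R) →ₗ[R] M')
    (hp : Function.Surjective p) (hp' : Function.Surjective p')
    (hker : ∀ x, p x = 0 → ∀ i, x i ∈ I) (hker' : ∀ x, p' x = 0 → ∀ i, x i ∈ I) :
    r = r' ∧ StablyIsomorphic R (LinearMap.ker p) (LinearMap.ker p') := by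
  have : Nontrivial (R ⧸ I) := Ideal.Quotient.nontrivial_iff.2 hI
  have : Nontrivial R := (Ideal.Quotient.mk_surjective (I := I)).nontrivial
  obtain ⟨ι, _, ⟨e⟩⟩ := h
  let q : ((Fin r → R) × (ι → R)) →ₗ[R] (M' × (ι → R)) :=
    e.toLinearMap ∘ₗ p.prodMap LinearMap.id
  let q' : ((Fin r' → R) × (ι → R)) →ₗ[R] (M' × (ι → R)) := p'.prodMap LinearMap.id
  have hq : Function.Surjective q :=
    e.surjective.comp (Prod.map_surjective.2 ⟨hp, Function.surjective_id⟩)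
  have hq' : Function.Surjective q' := Prod.map_surjective.2 ⟨hp', Function.surjective_id⟩
  have hq0 : ∀ x, q x = 0 ↔ p x.1 = 0 ∧ x.2 = 0 := fun x => by
    simp [q, Prod.ext_iff]
  have hq0' : ∀ x, q' x = 0 ↔ p' x.1 = 0 ∧ x.2 = 0 := fun x => by
    simp [q', Prod.ext_iff]
  have hmem : ∀ (s : ℕ) (x : Fin s → R), (∀ i, x i ∈ I) →
      ((x, 0) : (Fin s → R) × (ι → R)) ∈ (I • ⊤ : Submodule R ((Fin s → R) × (ι → R))) := by
    intro s x hx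
    have h1 := Submodule.mem_map_of_mem (f := LinearMap.inl R (Fin s → R) (ι → R))
      (mem_smul_top_of_forall_mem hx)
    rw [Submodule.map_smul''] at h1
    exact Submodule.smul_mono le_rfl le_top h1
  have hle : LinearMap.ker q ≤ I • ⊤ := by
    rintro ⟨x, y⟩ hx
    obtain ⟨h1, h2⟩ := (hq0 _).1 hx
    cases h2
    exact hmem _ _ (hker _ h1)
  have hle' : LinearMap.ker q' ≤ I • ⊤ := by
    rintro ⟨x, y⟩ hx
    obtain ⟨h1, h2⟩ := (hq0' _).1 hx
    cases h2
    exact hmem _ _ (hker' _ h1)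
  have h1 := finrank_le_of_ker_le hI q q' hq hq' hle
  have h2 := finrank_le_of_ker_le hI q' q hq' hq hle'
  have hrank : r = r' := by
    have h3 := le_antisymm h1 h2
    rw [Module.finrank_prod, Module.finrank_prod] at h3
    simpa using h3
  refine ⟨hrank, ?_⟩
  subst hrank
  obtain ⟨e'⟩ := exists_ker_prod_equiv q q' hq hq'
  have ek : LinearMap.ker q ≃ₗ[R] LinearMap.ker p :=
    { toFun := fun x => ⟨x.1.1, ((hq0 _).1 x.2).1⟩
      invFun := fun x => ⟨(x.1, 0), (hq0 _).2 ⟨x.2, rfl⟩⟩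
      map_add' := fun _ _ => rfl
      map_smul' := fun _ _ => rfl
      left_inv := fun x => Subtype.ext (Prod.ext rfl ((hq0 _).1 x.2).2.symm)
      right_inv := fun _ => rfl }
  have ek' : LinearMap.ker q' ≃ₗ[R] LinearMap.ker p' :=
    { toFun := fun x => ⟨x.1.1, ((hq0' _).1 x.2).1⟩
      invFun := fun x => ⟨(x.1, 0), (hq0' _).2 ⟨x.2, rfl⟩⟩
      map_add' := fun _ _ => rfl
      map_smul' := fun _ _ => rfl
      left_inv := fun x => Subtype.ext (Prod.ext rfl ((hq0' _).1 x.2).2.symm)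
      right_inv := fun _ => rfl }
  have es := LinearEquiv.sumArrowLequivProdArrow (Fin r) ι R R
  exact ⟨Fin r ⊕ ι, inferInstance, ⟨(LinearEquiv.prodCongr ek.symm es).trans <|
    e'.trans (LinearEquiv.prodCongr ek' es.symm)⟩⟩

end Schanuel

/-! ### Invariance of the ranks of a minimal resolution. -/

namespace MinimalGradedFreeResolution

variable {k : Type u} [Field k] {R : Type v} [CommRing R] [Algebra k R]
  {𝒜 : ℕ → Submodule k R} [GradedAlgebra 𝒜]
  {M : Type w} [AddCommGroup M] [Module k M] [Module R M] {ℳ : ℕ → Submodule k M}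
  (F : MinimalGradedFreeResolution 𝒜 ℳ)

/-- The kernel of the map out of the `i`-th free module. -/
def syzygy : (i : ℕ) → Submodule R (Fin (F.rank i) → R)
  | 0 => LinearMap.ker F.aug
  | i + 1 => LinearMap.ker (F.d i)

theorem range_d (i : ℕ) : LinearMap.range (F.d i) = F.syzygy i := by
  cases i with
  | zero => exact F.exact_zero.linearMap_ker_eq.symm
  | succ i => exact (F.exact_succ i).linearMap_ker_eq.symm

theorem mem_irrelevant_of_mem_syzygy {i : ℕ} {x : Fin (F.rank i) → R} (hx : x ∈ F.syzygy i)
    (p : Fin (F.rank i)) : x p ∈ (HomogeneousIdeal.irrelevant 𝒜).toIdeal := by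
  rw [← F.range_d] at hx
  obtain ⟨y, rfl⟩ := hx
  exact F.d_mem_irrelevant i y p

/-- The differential as a map onto the syzygy module. -/
def dSyzygy (i : ℕ) : (Fin (F.rank (i + 1)) → R) →ₗ[R] F.syzygy i :=
  (F.d i).codRestrict _ fun x => by rw [← F.range_d]; exact ⟨x, rfl⟩

theorem dSyzygy_surjective (i : ℕ) : Function.Surjective (F.dSyzygy i) := by
  rintro ⟨x, hx⟩
  obtain ⟨y, hy⟩ : x ∈ LinearMap.range (F.d i) := by rw [F.range_d]; exact hx
  exact ⟨y, Subtype.ext hy⟩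

theorem ker_dSyzygy (i : ℕ) : LinearMap.ker (F.dSyzygy i) = F.syzygy (i + 1) :=
  LinearMap.ker_codRestrict _ _ _

/-- The ranks in a minimal resolution do not depend on the resolution. -/
theorem rank_eq [Nontrivial R] (F' : MinimalGradedFreeResolution 𝒜 ℳ) (i : ℕ) :
    F.rank i = F'.rank i := by
  have hI : (HomogeneousIdeal.irrelevant 𝒜).toIdeal ≠ ⊤ := fun h =>
    one_notMem_irrelevant (𝒜 := 𝒜) (h ▸ Submodule.mem_top)
  -- The induction needs the syzygies as well, and these are only controlled up to stable
  -- isomorphism.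
  suffices F.rank i = F'.rank i ∧ StablyIsomorphic R (F.syzygy i) (F'.syzygy i) from this.1
  induction i with
  | zero =>
    have h : StablyIsomorphic R M M := ⟨Empty, inferInstance, ⟨LinearEquiv.refl _ _⟩⟩
    exact h.rank_eq_and_ker hI F.aug F'.aug F.aug_surjective F'.aug_surjective
      (fun x hx => F.mem_irrelevant_of_mem_syzygy (i := 0) hx)
      (fun x hx => F'.mem_irrelevant_of_mem_syzygy (i := 0) hx)
  | succ i ih =>
    have := ih.2.rank_eq_and_ker hI (F.dSyzygy i) (F'.dSyzygy i) (F.dSyzygy_surjective i)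
      (F'.dSyzygy_surjective i)
      (fun x hx => F.mem_irrelevant_of_mem_syzygy (i := i + 1)
        (by rw [← F.ker_dSyzygy]; exact hx))
      (fun x hx => F'.mem_irrelevant_of_mem_syzygy (i := i + 1)
        (by rw [← F'.ker_dSyzygy]; exact hx))
    rwa [F.ker_dSyzygy, F'.ker_dSyzygy] at this

end MinimalGradedFreeResolution

/-! ### The residue field as a graded module. -/

section ResidueField

variable {k : Type u} [Field k] {R : Type v} [CommRing R] [Algebra k R]
  {𝒜 : ℕ → Submodule k R} [GradedAlgebra 𝒜]

theorem gradedResidueFieldGrading_eq_bot {j : ℕ} (hj : j ≠ 0) :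
    gradedResidueFieldGrading 𝒜 j = ⊥ := by
  rw [eq_bot_iff]
  rintro _ ⟨x, hx, rfl⟩
  refine (Submodule.mem_bot k).2 (Ideal.Quotient.eq_zero_iff_mem.2 ?_)
  refine (HomogeneousIdeal.mem_irrelevant_iff 𝒜 x).2 ?_
  rw [GradedRing.proj_apply, DirectSum.decompose_of_mem_ne _ hx hj]

theorem gradedResidueFieldGrading_smul_mem (n m : ℕ) (a : R) (ha : a ∈ 𝒜 n)
    (x : GradedResidueField 𝒜) (hx : x ∈ gradedResidueFieldGrading 𝒜 m) :
    a • x ∈ gradedResidueFieldGrading 𝒜 (n + m) := by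
  obtain ⟨y, hy, rfl⟩ := hx
  exact ⟨a * y, SetLike.mul_mem_graded ha hy, rfl⟩

theorem gradedResidueFieldGrading_hasGradedProjections :
    HasGradedProjections (gradedResidueFieldGrading 𝒜) := by
  intro j
  by_cases hj : j = 0
  · refine ⟨AddMonoidHom.id _, fun _ _ => rfl, fun i hi n hn => ?_⟩
    rw [gradedResidueFieldGrading_eq_bot (hj ▸ hi)] at hn
    exact (Submodule.mem_bot k).1 hn
  · refine ⟨0, fun n hn => ?_, fun _ _ _ _ => rfl⟩
    rw [gradedResidueFieldGrading_eq_bot hj] at hn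
    exact ((Submodule.mem_bot k).1 hn).symm

theorem nontrivial_gradedResidueField [Nontrivial R] : Nontrivial (GradedResidueField 𝒜) :=
  Ideal.Quotient.nontrivial_iff.2 fun h =>
    MinimalGradedFreeResolution.one_notMem_irrelevant (𝒜 := 𝒜) (h ▸ Submodule.mem_top)

theorem finrank_gradedResidueFieldGrading [Nontrivial R] (h0 : 𝒜 0 = 1) (j : ℕ) :
    Module.finrank k (gradedResidueFieldGrading 𝒜 j) = if j = 0 then 1 else 0 := by
  split_ifs with hj
  · subst hj
    have := nontrivial_gradedResidueField (𝒜 := 𝒜)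
    rw [gradedResidueFieldGrading, h0, Submodule.one_eq_span, Submodule.map_span,
      Set.image_singleton]
    refine finrank_span_singleton ?_
    change (1 : GradedResidueField 𝒜) ≠ 0
    exact one_ne_zero
  · rw [gradedResidueFieldGrading_eq_bot hj, finrank_bot]

end ResidueField

/-! ### Linear resolutions. -/

namespace MinimalGradedFreeResolution

section Linear

variable {k : Type u} [Field k] {R : Type v} [CommRing R] [Algebra k R]
  {𝒜 : ℕ → Submodule k R} [GradedAlgebra 𝒜]

theorem eulerSeries_mul_gradedHilbertSeries_residueField [Nontrivial R]
    [∀ j, Module.Finite k (𝒜 j)] (h0 : 𝒜 0 = 1)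
    (F : MinimalGradedFreeResolution 𝒜 (gradedResidueFieldGrading 𝒜)) :
    F.eulerSeries * gradedHilbertSeries 𝒜 = 1 := by
  rw [F.eulerSeries_mul_gradedHilbertSeries gradedResidueFieldGrading_smul_mem
    gradedResidueFieldGrading_hasGradedProjections]
  ext j
  rw [PowerSeries.coeff_mk, finrank_gradedResidueFieldGrading h0, PowerSeries.coeff_one]
  split_ifs <;> rfl

variable {M : Type w} [AddCommGroup M] [Module k M] [Module R M] {ℳ : ℕ → Submodule k M}

theorem coeff_coeff_poincareSeries (F : MinimalGradedFreeResolution 𝒜 ℳ) (i j : ℕ) :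
    PowerSeries.coeff j (PowerSeries.coeff i F.poincareSeries) = F.betti i j := by
  rw [poincareSeries, PowerSeries.coeff_mk, PowerSeries.coeff_mk]

theorem betti_eq_rank {F : MinimalGradedFreeResolution 𝒜 ℳ} {i j : ℕ}
    (h : ∀ q, F.deg i q = j) : F.betti i j = F.rank i := by
  rw [betti, Finset.filter_true_of_mem fun q _ => h q, Finset.card_fin]

theorem betti_eq_zero {F : MinimalGradedFreeResolution 𝒜 ℳ} {i j : ℕ}
    (h : ∀ q, F.deg i q ≠ j) : F.betti i j = 0 := by
  rw [betti, Finset.filter_false_of_mem fun q _ => h q, Finset.card_empty]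

theorem coeff_eulerSeries_of_linear {F : MinimalGradedFreeResolution 𝒜 ℳ} {j : ℕ}
    (h : ∀ i < j, ∀ q, F.deg i q = i) :
    PowerSeries.coeff j F.eulerSeries = (-1) ^ j * (F.betti j j : ℤ) := by
  rw [eulerSeries, PowerSeries.coeff_mk, Finset.sum_range_succ, Finset.sum_eq_zero, zero_add]
  intro i hi
  have hi' := Finset.mem_range.1 hi
  rw [betti_eq_zero fun q => (h i hi' q).trans_ne hi'.ne]
  simp

/-- If one minimal resolution of a module is linear, then so are all others with the same Euler
series. -/
theorem deg_eq_of_linear [Nontrivial R] (F K : MinimalGradedFreeResolution 𝒜 ℳ)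
    (hF : ∀ i q, F.deg i q = i) (h : F.eulerSeries = K.eulerSeries) (i : ℕ) :
    ∀ q, K.deg i q = i := by
  induction i using Nat.strong_induction_on with
  | _ i ih =>
    -- When the earlier modules are linear, only `β_{i,i}` contributes to the coefficient of degree
    -- `i`. So `β_{i,i}(K) = β_{i,i}(F) = rank F_i = rank K_i`, which leaves no generator of `K_i`
    -- in another degree.
    have h1 := congrArg (PowerSeries.coeff i) h
    rw [coeff_eulerSeries_of_linear fun j _ => hF j, coeff_eulerSeries_of_linear ih,
      betti_eq_rank (hF i), F.rank_eq K i] at h1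
    have h2 : K.rank i = K.betti i i := by
      exact_mod_cast mul_left_cancel₀ (pow_ne_zero i (by norm_num : (-1 : ℤ) ≠ 0)) h1
    intro q
    have h3 := Finset.filter_card_eq (s := Finset.univ) (p := fun q => K.deg i q = i)
      (by rw [Finset.card_fin]; exact h2.symm)
    exact h3 q (Finset.mem_univ q)

theorem rank_zero_pos [Nontrivial M] (F : MinimalGradedFreeResolution 𝒜 ℳ) : 0 < F.rank 0 := by
  rcases Nat.eq_zero_or_pos (F.rank 0) with h | h
  · have : IsEmpty (Fin (F.rank 0)) := by rw [h]; infer_instance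
    exact absurd F.aug_surjective.subsingleton (not_subsingleton M)
  · exact h

end Linear

end MinimalGradedFreeResolution

/-! ### Diagonal power series in two variables. -/

section Diagonal

theorem coeff_coeff_mul {S : Type*} [CommSemiring S] (P Z : PowerSeries (PowerSeries S))
    (i j : ℕ) :
    PowerSeries.coeff j (PowerSeries.coeff i (P * Z)) =
      ∑ p ∈ Finset.HasAntidiagonal.antidiagonal i, ∑ q ∈ Finset.HasAntidiagonal.antidiagonal j,
        PowerSeries.coeff q.1 (PowerSeries.coeff p.1 P) *
          PowerSeries.coeff q.2 (PowerSeries.coeff p.2 Z) := by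
  rw [PowerSeries.coeff_mul, map_sum]
  exact Finset.sum_congr rfl fun p _ => PowerSeries.coeff_mul _ _ _

/-- If `P (1 - Z) = L` for series with nonnegative coefficients and `P` is diagonal, then so is
`Z`. -/
theorem coeff_coeff_eq_zero_of_diagonal {P Z L : PowerSeries (PowerSeries ℤ)}
    (h : P * (1 - Z) = L)
    (hP : ∀ i j, 0 ≤ PowerSeries.coeff j (PowerSeries.coeff i P))
    (hZ : ∀ i j, 0 ≤ PowerSeries.coeff j (PowerSeries.coeff i Z))
    (hL : ∀ i j, 0 ≤ PowerSeries.coeff j (PowerSeries.coeff i L))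
    (hP0 : 0 < PowerSeries.coeff 0 (PowerSeries.coeff 0 P))
    (hdiag : ∀ i j, i ≠ j → PowerSeries.coeff j (PowerSeries.coeff i P) = 0)
    {i j : ℕ} (hij : i ≠ j) : PowerSeries.coeff j (PowerSeries.coeff i Z) = 0 := by
  have h1 := hL i j
  rw [← h, mul_sub, mul_one, map_sub, map_sub, hdiag i j hij, coeff_coeff_mul] at h1
  -- Among the nonnegative terms of `(P Z)_{ij}`, keep only `P₀₀ Z_{ij}`.
  have h2 := Finset.single_le_sum (s := Finset.HasAntidiagonal.antidiagonal i)
    (f := fun p => ∑ q ∈ Finset.HasAntidiagonal.antidiagonal j,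
        PowerSeries.coeff q.1 (PowerSeries.coeff p.1 P) *
          PowerSeries.coeff q.2 (PowerSeries.coeff p.2 Z))
    (fun p _ => Finset.sum_nonneg fun q _ => mul_nonneg (hP _ _) (hZ _ _))
    (a := (0, i)) (by simp)
  have h3 := Finset.single_le_sum (s := Finset.HasAntidiagonal.antidiagonal j)
    (f := fun q => PowerSeries.coeff q.1 (PowerSeries.coeff 0 P) *
          PowerSeries.coeff q.2 (PowerSeries.coeff i Z))
    (fun q _ => mul_nonneg (hP _ _) (hZ _ _))
    (a := (0, j)) (by simp)
  have h4 : PowerSeries.coeff 0 (PowerSeries.coeff 0 P) *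
      PowerSeries.coeff j (PowerSeries.coeff i Z) ≤ 0 := by
    simp only at h2 h3
    linarith
  exact le_antisymm (nonpos_of_mul_nonpos_right h4 hP0) (hZ i j)

end Diagonal

/-! ### The resolution of `R` over `Q`. -/

namespace MinimalGradedFreeResolution

section Relative

variable {k : Type u} [Field k] {Q : Type w} [CommRing Q] [Algebra k Q]
  {R : Type v} [CommRing R] [Algebra k R] {𝒬 : ℕ → Submodule k Q} [GradedAlgebra 𝒬]
  {𝒜 : ℕ → Submodule k R} [GradedAlgebra 𝒜] [Module Q R]
  (G : MinimalGradedFreeResolution 𝒬 𝒜)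

/-- A minimal resolution of a cyclic algebra starts with a single generator, of degree `0`. -/
theorem exists_aug_eq [Nontrivial R] {φ : Q →+* R} (hφ : Function.Surjective φ)
    (hsmul : ∀ (x : Q) (y : R), x • y = φ x * y) :
    ∃ (q : Fin (G.rank 0)) (u : R), (∀ p, p = q) ∧ G.deg 0 q = 0 ∧ IsUnit u ∧
      ∀ x, G.aug x = φ (x q) * u := by
  have : Nontrivial Q := hφ.nontrivial
  obtain ⟨v, hv⟩ := G.aug_surjective 1
  -- Since `R` is cyclic over `Q`, each basis vector is a multiple of `v` modulo the kernel of the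
  -- augmentation, which lies in the irrelevant ideal times the free module.
  have hc : ∀ q, ∃ c : Q, ∀ p, (Pi.single q 1 - c • v : Fin (G.rank 0) → Q) p ∈
      (HomogeneousIdeal.irrelevant 𝒬).toIdeal := by
    intro q
    obtain ⟨c, hc⟩ := hφ (G.aug (Pi.single q 1))
    refine ⟨c, G.mem_irrelevant_of_mem_syzygy (i := 0) ?_⟩
    change G.aug _ = 0
    rw [map_sub, map_smul, hv, hsmul, hc, mul_one, sub_self]
  have huniq : ∀ p q : Fin (G.rank 0), p = q := by
    intro p q
    by_contra hpq
    -- Two distinct basis vectors would both be multiples of `v` modulo the irrelevant ideal;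
    -- eliminating the coordinates of `v` puts `1` in that ideal.
    obtain ⟨c, hc'⟩ := hc q
    obtain ⟨b, hb⟩ := hc p
    have h1 := hc' q
    have h2 := hc' p
    have h3 := hb p
    have h4 := hb q
    simp only [Pi.sub_apply, Pi.smul_apply, smul_eq_mul, Pi.single_eq_same,
      Pi.single_eq_of_ne hpq, Pi.single_eq_of_ne (Ne.symm hpq)] at h1 h2 h3 h4
    refine one_notMem_irrelevant (𝒜 := 𝒬) ?_
    have h5 := Ideal.add_mem _ (Ideal.add_mem _ h1 (Ideal.mul_mem_left _ (c * v q) h3))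
      (Ideal.mul_mem_left _ (0 - c * v p) h4)
    have h6 : (1 : Q) = 1 - c * v q + c * v q * (1 - b * v p) + (0 - c * v p) * (0 - b * v q) := by
      ring
    rwa [← h6] at h5
  let q : Fin (G.rank 0) := ⟨0, G.rank_zero_pos⟩
  have haug : ∀ x, G.aug x = φ (x q) * G.aug (Pi.single q 1) := by
    intro x
    rw [← hsmul, ← map_smul, ← Pi.single_smul, smul_eq_mul, mul_one]
    congr 1
    ext p
    rw [huniq p q, Pi.single_eq_same]
  have h1 := (haug v).symm.trans hv
  refine ⟨q, _, fun p => huniq p q, ?_, IsUnit.of_mul_eq_one_right _ h1, haug⟩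
  -- A generator of positive degree could not contribute to the degree `0` element `1`.
  by_contra hdeg
  have h2 := DirectSum.coe_decompose_mul_of_right_mem_of_not_le 𝒜 (n := 0) (a := φ (v q))
    (G.aug_homogeneous q) (by omega)
  rw [h1, DirectSum.decompose_of_mem_same _ (SetLike.GradedOne.one_mem (A := 𝒜))] at h2
  exact one_ne_zero h2

/-- The generating function of the ranks in positive homological degrees, shifted by one. -/
noncomputable def shiftedRankSeries : PowerSeries ℤ :=
  PowerSeries.mk fun n => if 2 ≤ n then (G.rank (n - 1) : ℤ) else 0

variable {G}

/-- The factor `z` in `z (P^Q_R - 1)` moves `β_{i,j}` to homological index `i + 1`, so diagonality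
reads `j = i + 1`. The generator of `G_0` in degree `0` keeps the coefficients nonnegative after
subtracting `1`. -/
theorem deg_eq_succ_of_golod [Nontrivial R] {φ : Q →+* R} (hφ : Function.Surjective φ)
    (hsmul : ∀ (x : Q) (y : R), x • y = φ x * y)
    {K : MinimalGradedFreeResolution 𝒜 (gradedResidueFieldGrading 𝒜)}
    {L : MinimalGradedFreeResolution 𝒬 (gradedResidueFieldGrading 𝒬)}
    (h : K.poincareSeries * (1 - PowerSeries.X * (G.poincareSeries - 1)) = L.poincareSeries)
    (hK : ∀ i q, K.deg i q = i) {i : ℕ} (hi : i ≠ 0) (q : Fin (G.rank i)) :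
    G.deg i q = i + 1 := by
  obtain ⟨q₀, u, huniq, hdeg, -, -⟩ := G.exists_aug_eq hφ hsmul
  have hG0 : 1 ≤ G.betti 0 0 := by
    rw [betti, Nat.one_le_iff_ne_zero, Finset.card_ne_zero]
    exact ⟨q₀, by simp [hdeg]⟩
  have := nontrivial_gradedResidueField (𝒜 := 𝒜)
  by_contra hq
  have h1 := coeff_coeff_eq_zero_of_diagonal h (fun i j => by rw [coeff_coeff_poincareSeries]; positivity)
    (fun i j => ?_) (fun i j => by rw [coeff_coeff_poincareSeries]; positivity)
    (by rw [coeff_coeff_poincareSeries, betti_eq_rank (hK 0)]; exact_mod_cast K.rank_zero_pos)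
    (fun i j hij => by rw [coeff_coeff_poincareSeries, betti_eq_zero fun q => (hK i q).trans_ne hij]; rfl)
    (Ne.symm hq)
  · rw [PowerSeries.coeff_succ_X_mul, map_sub, map_sub, coeff_coeff_poincareSeries,
      PowerSeries.coeff_one, if_neg hi, map_zero, sub_zero, Nat.cast_eq_zero, betti,
      Finset.card_eq_zero, Finset.filter_eq_empty_iff] at h1
    exact h1 (Finset.mem_univ q) rfl
  · cases i with
    | zero => rw [PowerSeries.coeff_zero_X_mul, map_zero]
    | succ i =>
      rw [PowerSeries.coeff_succ_X_mul, map_sub, map_sub, coeff_coeff_poincareSeries,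
        PowerSeries.coeff_one]
      split_ifs with hi
      · subst hi
        rw [PowerSeries.coeff_one]
        split_ifs with hj
        · subst hj
          have : (1 : ℤ) ≤ G.betti 0 0 := by exact_mod_cast hG0
          linarith
        · simp
      · simp

theorem evalNegHom_eulerSeries [Nontrivial R] {φ : Q →+* R} (hφ : Function.Surjective φ)
    (hsmul : ∀ (x : Q) (y : R), x • y = φ x * y)
    (hG : ∀ i, i ≠ 0 → ∀ q, G.deg i q = i + 1) :
    PowerSeries.evalNegHom G.eulerSeries = 1 - G.shiftedRankSeries := by
  obtain ⟨q₀, u, huniq, hdeg, -, -⟩ := G.exists_aug_eq hφ hsmul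
  have hG0 : G.rank 0 = 1 := by
    have : Unique (Fin (G.rank 0)) := ⟨⟨q₀⟩, huniq⟩
    rw [← Fintype.card_fin (G.rank 0)]
    exact Fintype.card_unique
  have h0 : ∀ q, G.deg 0 q = 0 := fun q => huniq q ▸ hdeg
  ext j
  rw [PowerSeries.evalNegHom, PowerSeries.coeff_rescale, eulerSeries, PowerSeries.coeff_mk,
    map_sub, shiftedRankSeries, PowerSeries.coeff_mk, PowerSeries.coeff_one]
  rcases j with _ | _ | j
  · simp [betti_eq_rank h0, hG0]
  · rw [Finset.sum_range_succ, Finset.sum_range_one, betti_eq_zero fun q => by rw [h0]; omega,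
      betti_eq_zero fun q => by rw [hG 1 one_ne_zero]; omega]
    simp
  · rw [Finset.sum_eq_single (j + 1)]
    · rw [betti_eq_rank (hG (j + 1) (by omega)), ← mul_assoc, ← pow_add]
      have : (-1 : ℤ) ^ (j + 1 + 1 + (j + 1)) = -1 := Odd.neg_one_pow ⟨j + 1, by ring⟩
      rw [this]
      simp
    · intro i _ hi
      rcases Nat.eq_zero_or_pos i with rfl | hi0
      · rw [betti_eq_zero fun q => by rw [h0]; omega]
        simp
      · rw [betti_eq_zero fun q => by rw [hG i hi0.ne']; omega]
        simp
    · intro h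
      exact absurd (Finset.mem_range.2 (by omega)) h

theorem injective_of_rank_one_eq_zero [Nontrivial R] {φ : Q →+* R} (hφ : Function.Surjective φ)
    (hsmul : ∀ (x : Q) (y : R), x • y = φ x * y) (h1 : G.rank 1 = 0) :
    Function.Injective φ := by
  obtain ⟨q₀, u, -, -, -, haug⟩ := G.exists_aug_eq hφ hsmul
  have : IsEmpty (Fin (G.rank (0 + 1))) := by rw [zero_add, h1]; infer_instance
  rw [injective_iff_map_eq_zero]
  intro x hx
  obtain ⟨y, hy⟩ := (G.exact_zero (Pi.single q₀ x)).1 (by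
    rw [haug, Pi.single_eq_same, hx, zero_mul])
  rw [Subsingleton.elim y 0, map_zero] at hy
  simpa using (congrFun hy q₀).symm

/-- Here `G` is `0 → Q → Q → R` and its differential is multiplication by `f`. Exactness at `G_0`
identifies the kernel of `φ`; exactness at `G_1` makes `f` a nonzerodivisor. -/
theorem exists_ker_eq_span_singleton [Nontrivial R] {φ : Q →+* R} (hφ : Function.Surjective φ)
    (hsmul : ∀ (x : Q) (y : R), x • y = φ x * y) (h1 : G.rank 1 = 1) (h2 : G.rank 2 = 0) :
    ∃ (e : ℕ) (f : Q), f ∈ 𝒬 e ∧ RingHom.ker φ = Ideal.span {f} ∧ ∀ x, f * x = 0 → x = 0 := by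
  obtain ⟨q₀, u, huniq, hdeg, hu, haug⟩ := G.exists_aug_eq hφ hsmul
  have : IsEmpty (Fin (G.rank (1 + 1))) := by rw [h2]; infer_instance
  have hsub : Subsingleton (Fin (G.rank (0 + 1))) := by rw [zero_add, h1]; infer_instance
  let q₁ : Fin (G.rank (0 + 1)) := ⟨0, by rw [zero_add, h1]; exact one_pos⟩
  have hd : ∀ y, G.d 0 y q₀ = G.d 0 (Pi.single q₁ 1) q₀ * y q₁ := by
    intro y
    have : y = y q₁ • (Pi.single q₁ 1 : Fin (G.rank (0 + 1)) → Q) := by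
      ext p
      rw [Subsingleton.elim p q₁]
      simp
    conv_lhs => rw [this, map_smul, Pi.smul_apply, smul_eq_mul, mul_comm]
  refine ⟨G.deg 1 q₁, G.d 0 (Pi.single q₁ 1) q₀, ?_, ?_, ?_⟩
  · have := mem_freePiece.1 (G.d_single_mem 0 q₁) q₀
    rwa [hdeg, shiftedPiece_of_le (Nat.zero_le _)] at this
  · ext x
    rw [RingHom.mem_ker, Ideal.mem_span_singleton]
    constructor
    · intro hx
      obtain ⟨y, hy⟩ := (G.exact_zero (Pi.single q₀ x)).1 (by
        rw [haug, Pi.single_eq_same, hx, zero_mul])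
      refine ⟨y q₁, ?_⟩
      rw [← hd, hy, Pi.single_eq_same]
    · rintro ⟨y, rfl⟩
      have h3 := (G.exact_zero _).2 ⟨Pi.single q₁ 1, rfl⟩
      rw [haug, hu.mul_left_eq_zero] at h3
      rw [map_mul, h3, zero_mul]
  · intro x hx
    obtain ⟨y, hy⟩ := (G.exact_succ 0 (Pi.single q₁ x)).1 (by
      ext p
      rw [huniq p, hd, Pi.single_eq_same, hx]
      rfl)
    rw [Subsingleton.elim y 0, map_zero] at hy
    simpa using (congrFun hy q₁).symm

end Relative

end MinimalGradedFreeResolution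

/-! ### Hilbert series modulo a regular sequence. -/

section IdealHilbertSeries

variable {k : Type u} [Field k] {S : Type v} [CommRing S] [Algebra k S]
  (𝒮 : ℕ → Submodule k S)

/-- The Hilbert series of the quotient of a graded algebra by an ideal, computed in the algebra. -/
noncomputable def idealHilbertSeries (I : Ideal S) : PowerSeries ℤ :=
  PowerSeries.mk fun j => (Module.finrank k (𝒮 j) : ℤ) -
    Module.finrank k (I.restrictScalars k ⊓ 𝒮 j : Submodule k S)

variable {𝒮}

theorem idealHilbertSeries_bot : idealHilbertSeries 𝒮 ⊥ = gradedHilbertSeries 𝒮 := by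
  ext j
  have h : ((⊥ : Ideal S).restrictScalars k ⊓ 𝒮 j : Submodule k S) = ⊥ :=
    eq_bot_iff.2 fun x hx => hx.1
  rw [idealHilbertSeries, gradedHilbertSeries, PowerSeries.coeff_mk, PowerSeries.coeff_mk, h,
    finrank_bot, Nat.cast_zero, sub_zero]

theorem finrank_map_mulLeft [IsDomain S] {f : S} (hf : f ≠ 0) (N : Submodule k S) :
    Module.finrank k (N.map (LinearMap.mulLeft k f)) = Module.finrank k N :=
  (Submodule.equivMapOfInjective _ (mul_right_injective₀ hf) N).finrank_eq.symm

variable [GradedAlgebra 𝒮]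

/-- In degree `j ≥ e` the new ideal is `I_j + f S_{j-e}`, and regularity gives `I_j ∩ f S_{j-e} = f
I_{j-e}`. The formula for the dimension of a sum of subspaces concludes, as multiplication by `f`
preserves dimensions in a domain. -/
theorem idealHilbertSeries_sup_span_singleton [IsDomain S] [∀ j, Module.Finite k (𝒮 j)]
    {I : Ideal S} (hI : I.IsHomogeneous 𝒮) {e : ℕ} {f : S} (hf : f ∈ 𝒮 e) (hf0 : f ≠ 0)
    (hreg : ∀ x, f * x ∈ I → x ∈ I) :
    idealHilbertSeries 𝒮 (I ⊔ Ideal.span {f}) =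
      (1 - PowerSeries.X ^ e) * idealHilbertSeries 𝒮 I := by
  have hmem : ∀ j, ∀ x ∈ (I ⊔ Ideal.span {f}), x ∈ 𝒮 j → ∃ a ∈ I, a ∈ 𝒮 j ∧ ∃ b,
      x = a + (DirectSum.decompose 𝒮 (f * b) j : S) := by
    intro j x hx hxj
    obtain ⟨a, ha, c, hc, rfl⟩ := Submodule.mem_sup.1 hx
    obtain ⟨b, rfl⟩ := Ideal.mem_span_singleton.1 hc
    refine ⟨_, hI j ha, SetLike.coe_mem _, b, ?_⟩
    rw [← DirectSum.decompose_of_mem_same 𝒮 hxj]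
    simp [DirectSum.decompose_add]
  ext j
  rw [sub_mul, one_mul, map_sub, PowerSeries.coeff_X_pow_mul']
  simp only [idealHilbertSeries, PowerSeries.coeff_mk]
  split_ifs with he
  · have h1 : ((I ⊔ Ideal.span {f}).restrictScalars k ⊓ 𝒮 j : Submodule k S) =
        (I.restrictScalars k ⊓ 𝒮 j) ⊔ (𝒮 (j - e)).map (LinearMap.mulLeft k f) := by
      ext x
      constructor
      · rintro ⟨hx, hxj⟩
        obtain ⟨a, ha, haj, b, rfl⟩ := hmem j x hx hxj
        rw [DirectSum.coe_decompose_mul_of_left_mem_of_le 𝒮 hf he]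
        exact Submodule.add_mem_sup ⟨ha, haj⟩ ⟨_, SetLike.coe_mem _, rfl⟩
      · intro hx
        obtain ⟨a, ⟨ha, haj⟩, c, ⟨b, hb, rfl⟩, rfl⟩ := Submodule.mem_sup.1 hx
        have hfb : f * b ∈ 𝒮 j := by
          have := SetLike.mul_mem_graded hf hb
          rwa [Nat.add_sub_cancel' he] at this
        exact ⟨Submodule.add_mem_sup ha (Ideal.mul_mem_right _ _
          (Ideal.mem_span_singleton_self f)), add_mem haj hfb⟩
    have h2 : ((I.restrictScalars k ⊓ 𝒮 j) ⊓ (𝒮 (j - e)).map (LinearMap.mulLeft k f) :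
        Submodule k S) = (I.restrictScalars k ⊓ 𝒮 (j - e)).map (LinearMap.mulLeft k f) := by
      ext x
      constructor
      · rintro ⟨⟨hx, -⟩, b, hb, rfl⟩
        exact ⟨b, ⟨hreg b hx, hb⟩, rfl⟩
      · rintro ⟨b, ⟨hbI, hb⟩, rfl⟩
        have hfb : f * b ∈ 𝒮 j := by
          have := SetLike.mul_mem_graded hf hb
          rwa [Nat.add_sub_cancel' he] at this
        exact ⟨⟨I.mul_mem_left f hbI, hfb⟩, b, hb, rfl⟩
    have : Module.Finite k (I.restrictScalars k ⊓ 𝒮 j : Submodule k S) :=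
      Submodule.finiteDimensional_of_le inf_le_right
    have h3 := Submodule.finrank_sup_add_finrank_inf_eq
      (I.restrictScalars k ⊓ 𝒮 j : Submodule k S) ((𝒮 (j - e)).map (LinearMap.mulLeft k f))
    rw [h2, finrank_map_mulLeft hf0, finrank_map_mulLeft hf0, ← h1] at h3
    have h4 := congrArg (Nat.cast (R := ℤ)) h3
    push_cast at h4
    linarith
  · have h1 : ((I ⊔ Ideal.span {f}).restrictScalars k ⊓ 𝒮 j : Submodule k S) =
        I.restrictScalars k ⊓ 𝒮 j := by
      refine le_antisymm ?_ (inf_le_inf_right _ fun x hx => Submodule.mem_sup_left hx)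
      rintro x ⟨hx, hxj⟩
      obtain ⟨a, ha, haj, b, rfl⟩ := hmem j x hx hxj
      rw [DirectSum.coe_decompose_mul_of_left_mem_of_not_le 𝒮 hf he, add_zero]
      exact ⟨ha, haj⟩
    rw [h1, sub_zero]

theorem isHomogeneous_ofList {rs : List S} (hrs : ∀ f ∈ rs, ∃ e, f ∈ 𝒮 e) :
    (Ideal.ofList rs).IsHomogeneous 𝒮 :=
  Ideal.homogeneous_span 𝒮 _ hrs

theorem exists_idealHilbertSeries_ofList [IsDomain S] [∀ j, Module.Finite k (𝒮 j)]
    (rs : List S) (hrs : ∀ f ∈ rs, ∃ e, f ∈ 𝒮 e)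
    (hreg : RingTheory.Sequence.IsWeaklyRegular S rs) (htop : Ideal.ofList rs ≠ ⊤) :
    ∃ es : List ℕ, idealHilbertSeries 𝒮 (Ideal.ofList rs) =
      (es.map fun e => 1 - PowerSeries.X ^ e).prod * gradedHilbertSeries 𝒮 := by
  induction rs using List.reverseRecOn with
  | nil => exact ⟨[], by rw [Ideal.ofList_nil, idealHilbertSeries_bot]; simp⟩
  | append_singleton rs f ih =>
    rw [RingTheory.Sequence.isWeaklyRegular_append_iff] at hreg
    rw [Ideal.ofList_append, Ideal.ofList_singleton] at htop ⊢
    have hI : Ideal.ofList rs ≠ ⊤ := fun h => htop (by rw [h, top_sup_eq])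
    obtain ⟨es, hes⟩ := ih (fun g hg => hrs g (by simp [hg])) hreg.1 hI
    obtain ⟨e, he⟩ := hrs f (by simp)
    have hf : ∀ x, f * x ∈ Ideal.ofList rs → x ∈ Ideal.ofList rs := by
      intro x hx
      have h1 := ((RingTheory.Sequence.isWeaklyRegular_singleton_iff _ _).1 hreg.2)
      rw [isSMulRegular_iff_right_eq_zero_of_smul] at h1
      have h2 := h1 (Submodule.Quotient.mk x) (by
        rw [← Submodule.Quotient.mk_smul, Submodule.Quotient.mk_eq_zero]
        simpa using hx)
      rw [Submodule.Quotient.mk_eq_zero] at h2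
      simpa using h2
    -- If `f` were zero, regularity modulo the preceding elements would put `1` in their ideal.
    have hf0 : f ≠ 0 := by
      rintro rfl
      exact hI ((Ideal.eq_top_iff_one _).2 (hf 1 (by simp)))
    refine ⟨e :: es, ?_⟩
    rw [idealHilbertSeries_sup_span_singleton
      (isHomogeneous_ofList fun g hg => hrs g (by simp [hg])) he hf0 hf, hes]
    simp [mul_assoc]

variable {T : Type w} [CommRing T] [Algebra k T] {𝒯 : ℕ → Submodule k T} [GradedAlgebra 𝒯]

theorem map_eq_of_surjective {ψ : S →ₐ[k] T} (hψ : ∀ j, ∀ x ∈ 𝒮 j, ψ x ∈ 𝒯 j)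
    (hsurj : Function.Surjective ψ) (j : ℕ) : (𝒮 j).map ψ.toLinearMap = 𝒯 j := by
  have hdec : ∀ x, ψ (DirectSum.decompose 𝒮 x j : S) = (DirectSum.decompose 𝒯 (ψ x) j : T) := by
    intro x
    induction x using DirectSum.Decomposition.inductionOn 𝒮 with
    | zero => simp
    | @homogeneous i x =>
      by_cases hij : i = j
      · subst hij
        rw [DirectSum.decompose_of_mem_same _ x.2, DirectSum.decompose_of_mem_same _ (hψ i _ x.2)]
      · rw [DirectSum.decompose_of_mem_ne _ x.2 hij,
          DirectSum.decompose_of_mem_ne _ (hψ i _ x.2) hij, map_zero]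
    | add x y hx hy => simp [DirectSum.decompose_add, hx, hy]
  refine le_antisymm ?_ fun y hy => ?_
  · rintro _ ⟨x, hx, rfl⟩
    exact hψ j x hx
  · obtain ⟨x, rfl⟩ := hsurj y
    exact ⟨_, SetLike.coe_mem (DirectSum.decompose 𝒮 x j),
      (hdec x).trans (DirectSum.decompose_of_mem_same _ hy)⟩

theorem finite_of_surjective [∀ j, Module.Finite k (𝒮 j)] {ψ : S →ₐ[k] T}
    (hψ : ∀ j, ∀ x ∈ 𝒮 j, ψ x ∈ 𝒯 j) (hsurj : Function.Surjective ψ) (j : ℕ) :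
    Module.Finite k (𝒯 j) := by
  rw [← map_eq_of_surjective hψ hsurj j]
  infer_instance

theorem gradedHilbertSeries_eq_of_surjective [∀ j, Module.Finite k (𝒮 j)] {ψ : S →ₐ[k] T}
    (hψ : ∀ j, ∀ x ∈ 𝒮 j, ψ x ∈ 𝒯 j) (hsurj : Function.Surjective ψ) :
    gradedHilbertSeries 𝒯 = idealHilbertSeries 𝒮 (RingHom.ker ψ) := by
  ext j
  simp only [gradedHilbertSeries, idealHilbertSeries, PowerSeries.coeff_mk]
  have h1 := LinearMap.finrank_range_add_finrank_ker (ψ.toLinearMap.domRestrict (𝒮 j))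
  rw [LinearMap.range_domRestrict, map_eq_of_surjective hψ hsurj j] at h1
  have e : LinearMap.ker (ψ.toLinearMap.domRestrict (𝒮 j)) ≃ₗ[k]
      ((RingHom.ker ψ).restrictScalars k ⊓ 𝒮 j : Submodule k S) :=
    { toFun := fun x => ⟨x.1.1, LinearMap.mem_ker.1 x.2, x.1.2⟩
      invFun := fun x => ⟨⟨x.1, x.2.2⟩, LinearMap.mem_ker.2 x.2.1⟩
      map_add' := fun _ _ => rfl
      map_smul' := fun _ _ => rfl
      left_inv := fun _ => rfl
      right_inv := fun _ => rfl }
  rw [e.finrank_eq] at h1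
  have h2 := congrArg (Nat.cast (R := ℤ)) h1
  push_cast at h2
  linarith

end IdealHilbertSeries

/-! ### Hilbert series of polynomial rings and complete intersections. -/

section Polynomial

variable {k : Type u} [Field k]

instance finite_homogeneousSubmodule (n j : ℕ) :
    Module.Finite k (MvPolynomial.homogeneousSubmodule (Fin n) k j) :=
  Module.Finite.iff_fg.2 (MvPolynomial.homogeneousSubmodule_fg _ _ _)

theorem finrank_homogeneousSubmodule (n j : ℕ) :
    Module.finrank k (MvPolynomial.homogeneousSubmodule (Fin n) k j) = n.multichoose j := by
  have e := AddMonoidAlgebra.supportedEquivFinsupp (R := k) (S := k)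
    {d : Fin n →₀ ℕ | d.degree = j}
  rw [MvPolynomial.homogeneousSubmodule_eq_finsupp_supported]
  have hset : {d : Fin n →₀ ℕ | d.degree = j} =
      ((Finset.univ : Finset (Fin n)).finsuppAntidiag j : Set (Fin n →₀ ℕ)) := by
    ext d
    simp [Finsupp.degree_eq_sum]
  rw [hset] at e ⊢
  rw [e.finrank_eq, Module.finrank_finsupp_self]
  refine (Fintype.card_coe _).trans ?_
  rw [Finset.card_finsuppAntidiag_nat_eq_multichoose, Finset.card_fin]

theorem gradedHilbertSeries_homogeneousSubmodule (n : ℕ) :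
    gradedHilbertSeries (MvPolynomial.homogeneousSubmodule (Fin n) k) *
      (1 - PowerSeries.X) ^ n = 1 := by
  have h : gradedHilbertSeries (MvPolynomial.homogeneousSubmodule (Fin n) k) =
      (PowerSeries.invOneSubPow ℤ n).val := by
    ext j
    rw [gradedHilbertSeries, PowerSeries.coeff_mk, finrank_homogeneousSubmodule]
    rcases n with _ | n
    · rw [PowerSeries.invOneSubPow_zero, Units.val_one, PowerSeries.coeff_one]
      rcases j with _ | j <;> simp
    · rw [PowerSeries.invOneSubPow_val_succ_eq_mk_add_choose, PowerSeries.coeff_mk,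
        Nat.multichoose_eq, show n + 1 + j - 1 = n + j by omega, Nat.choose_symm_add]
  rw [h, ← PowerSeries.invOneSubPow_inv_eq_one_sub_pow]
  exact (PowerSeries.invOneSubPow ℤ n).val_inv

theorem map_mem_of_mem_homogeneousSubmodule {T : Type w} [CommRing T] [Algebra k T]
    {𝒯 : ℕ → Submodule k T} [GradedAlgebra 𝒯] {n : ℕ} {ψ : MvPolynomial (Fin n) k →ₐ[k] T}
    (hψ : ∀ i, ψ (MvPolynomial.X i) ∈ 𝒯 1) (j : ℕ) (x : MvPolynomial (Fin n) k)
    (hx : x ∈ MvPolynomial.homogeneousSubmodule (Fin n) k j) : ψ x ∈ 𝒯 j := by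
  rw [MvPolynomial.mem_homogeneousSubmodule] at hx
  rw [x.as_sum, map_sum]
  refine Submodule.sum_mem _ fun d hd => ?_
  rw [MvPolynomial.monomial_eq, ← MvPolynomial.smul_eq_C_mul, map_smul, Finsupp.prod_fintype _ _
    (fun _ => pow_zero _), map_prod]
  refine Submodule.smul_mem _ _ ?_
  have h1 := SetLike.prod_pow_mem_graded 𝒯 (F := Finset.univ) (i := fun _ => 1)
    (g := fun i => ψ (MvPolynomial.X i)) d fun i _ => hψ i
  have h2 : ∑ i, d i • 1 = j := by
    have h3 : d.degree = j := by
      by_contra hne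
      exact MvPolynomial.mem_support_iff.1 hd (hx.coeff_eq_zero hne)
    rw [← h3, Finsupp.degree_eq_sum]
    simp
  rw [h2] at h1
  simpa using h1

theorem exists_gradedHilbertSeries_mul_eq {Q : Type v} [CommRing Q] [Algebra k Q]
    {𝒬 : ℕ → Submodule k Q} [GradedAlgebra 𝒬] [Nontrivial Q] (h0 : 𝒬 0 = 1)
    (h : IsGradedCompleteIntersection 𝒬) :
    (∀ j, Module.Finite k (𝒬 j)) ∧ ∃ (n : ℕ) (es : List ℕ), (∀ e ∈ es, e ≠ 0) ∧
      gradedHilbertSeries 𝒬 * (1 - PowerSeries.X) ^ n =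
        (es.map fun e => 1 - PowerSeries.X ^ e).prod := by
  obtain ⟨n, ψ, rs, hX, hsurj, hrs, hreg, hker⟩ := h
  let _ := MvPolynomial.gradedAlgebra (σ := Fin n) (R := k)
  have hψ := map_mem_of_mem_homogeneousSubmodule hX
  refine ⟨finite_of_surjective hψ hsurj, n, ?_⟩
  obtain ⟨es, hes⟩ := exists_idealHilbertSeries_ofList
    (𝒮 := MvPolynomial.homogeneousSubmodule (Fin n) k) rs hrs hreg.toIsWeaklyRegular
    (fun h => hreg.top_ne_smul (by rw [h]; simp))
  have h1 : gradedHilbertSeries 𝒬 * (1 - PowerSeries.X) ^ n =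
        (es.map fun e => 1 - PowerSeries.X ^ e).prod := by
    rw [gradedHilbertSeries_eq_of_surjective hψ hsurj, hker, hes, mul_assoc,
      gradedHilbertSeries_homogeneousSubmodule, mul_one]
  -- A zero exponent would make the product vanish, whereas the Hilbert series of `Q` has constant
  -- term `1`.
  refine ⟨es, fun e he he0 => ?_, h1⟩
  rw [List.prod_eq_zero (List.mem_map.2 ⟨e, he, by simp [he0]⟩)] at h1
  have h2 := congrArg (PowerSeries.constantCoeff (R := ℤ)) h1
  have h3 : Module.finrank k (𝒬 0) = 1 := by
    rw [h0, Submodule.one_eq_span]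
    exact finrank_span_singleton one_ne_zero
  have h4 : PowerSeries.constantCoeff (gradedHilbertSeries 𝒬) = 1 := by
    rw [← PowerSeries.coeff_zero_eq_constantCoeff_apply, gradedHilbertSeries, PowerSeries.coeff_mk,
      h3, Nat.cast_one]
  simp [h4] at h2

end Polynomial

/-! ### Complete intersections under quotients by a nonzerodivisor. -/

section CompleteIntersection

variable {k : Type u} [Field k] {Q : Type w} [CommRing Q] [Algebra k Q]
  {R : Type v} [CommRing R] [Algebra k R] {𝒬 : ℕ → Submodule k Q} [GradedAlgebra 𝒬]
  {𝒜 : ℕ → Submodule k R} [GradedAlgebra 𝒜]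

theorem IsGradedCompleteIntersection.of_bijective (φ : 𝒬 →ₐᵍ[k] 𝒜)
    (hφ : Function.Bijective φ) (h : IsGradedCompleteIntersection 𝒬) :
    IsGradedCompleteIntersection 𝒜 := by
  obtain ⟨n, ψ, rs, hX, hsurj, hrs, hreg, hker⟩ := h
  refine ⟨n, φ.toAlgHom.comp ψ, rs, fun i => φ.map_mem (hX i), hφ.2.comp hsurj, hrs, hreg, ?_⟩
  rw [← hker]
  ext x
  exact map_eq_zero_iff φ hφ.1

/-- Lift `f` to a homogeneous polynomial `F` and append it to the regular sequence that presents
`Q`. -/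
theorem IsGradedCompleteIntersection.of_ker_eq_span_singleton [Nontrivial R] (φ : 𝒬 →ₐᵍ[k] 𝒜)
    (hφ : Function.Surjective φ) {e : ℕ} {f : Q} (hf : f ∈ 𝒬 e)
    (hker : RingHom.ker φ.toAlgHom = Ideal.span {f}) (hreg : ∀ x, f * x = 0 → x = 0)
    (h : IsGradedCompleteIntersection 𝒬) : IsGradedCompleteIntersection 𝒜 := by
  obtain ⟨n, ψ, rs, hX, hsurj, hrs, hrsreg, hψker⟩ := h
  let _ := MvPolynomial.gradedAlgebra (σ := Fin n) (R := k)
  obtain ⟨F, hF, hFf⟩ : f ∈ (MvPolynomial.homogeneousSubmodule (Fin n) k e).map ψ.toLinearMap := by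
    rw [map_eq_of_surjective (𝒯 := 𝒬) (map_mem_of_mem_homogeneousSubmodule hX) hsurj]
    exact hf
  have hFf' : ψ F = f := hFf
  have hkerφψ : RingHom.ker (φ.toAlgHom.comp ψ) = Ideal.ofList (rs ++ [F]) := by
    rw [Ideal.ofList_append, Ideal.ofList_singleton, ← hψker]
    ext x
    constructor
    · intro hx
      have h1 : ψ x ∈ RingHom.ker φ.toAlgHom := hx
      rw [hker, Ideal.mem_span_singleton] at h1
      obtain ⟨y, hy⟩ := h1
      obtain ⟨z, rfl⟩ := hsurj y
      have h2 : x = (x - F * z) + F * z := by ring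
      rw [h2]
      refine Submodule.add_mem_sup ?_ (Ideal.mul_mem_right _ _ (Ideal.mem_span_singleton_self F))
      rw [RingHom.mem_ker, map_sub, map_mul, hy, hFf', sub_self]
    · intro hx
      obtain ⟨a, ha, b, hb, rfl⟩ := Submodule.mem_sup.1 hx
      obtain ⟨z, rfl⟩ := Ideal.mem_span_singleton.1 hb
      have h1 : ψ a = 0 := ha
      have h2 : ψ (a + F * z) ∈ RingHom.ker φ.toAlgHom := by
        rw [hker, map_add, h1, zero_add, map_mul, hFf']
        exact Ideal.mul_mem_right _ _ (Ideal.mem_span_singleton_self f)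
      exact h2
  refine ⟨n, φ.toAlgHom.comp ψ, rs ++ [F], fun i => φ.map_mem (hX i), hφ.comp hsurj, ?_, ?_,
    hkerφψ⟩
  · intro g hg
    rcases List.mem_append.1 hg with hg | hg
    · exact hrs g hg
    · rw [List.mem_singleton.1 hg]
      exact ⟨e, hF⟩
  · refine ⟨?_, ?_⟩
    · rw [RingTheory.Sequence.isWeaklyRegular_append_iff,
        RingTheory.Sequence.isWeaklyRegular_singleton_iff,
        isSMulRegular_iff_right_eq_zero_of_smul]
      refine ⟨hrsreg.toIsWeaklyRegular, fun x hx => ?_⟩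
      obtain ⟨x, rfl⟩ := Submodule.Quotient.mk_surjective _ x
      rw [← Submodule.Quotient.mk_smul, Submodule.Quotient.mk_eq_zero] at hx
      rw [Submodule.Quotient.mk_eq_zero]
      simp only [smul_eq_mul, Ideal.mul_top, ← hψker, RingHom.mem_ker, map_mul, hFf'] at hx ⊢
      exact hreg _ hx
    · rw [smul_eq_mul, Ideal.mul_top, ← hkerφψ]
      exact fun h => RingHom.ker_ne_top _ h.symm

end CompleteIntersection

/-! ### Evaluation of power series near `-1`. -/

section Evaluation

/-- Absolute convergence of an integral power series at a real number. -/
def AbsConvergesAt (t : ℝ) (F : PowerSeries ℤ) : Prop :=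
  Summable fun n => ‖((PowerSeries.coeff n F : ℤ) : ℝ) * t ^ n‖

/-- The value of an integral power series at a real number. -/
noncomputable def seriesEval (t : ℝ) (F : PowerSeries ℤ) : ℝ :=
  ∑' n, ((PowerSeries.coeff n F : ℤ) : ℝ) * t ^ n

theorem coeff_mul_mul_pow (t : ℝ) (F G : PowerSeries ℤ) (n : ℕ) :
    ((PowerSeries.coeff n (F * G) : ℤ) : ℝ) * t ^ n =
      ∑ p ∈ Finset.HasAntidiagonal.antidiagonal n, (((PowerSeries.coeff p.1 F : ℤ) : ℝ) * t ^ p.1) *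
        (((PowerSeries.coeff p.2 G : ℤ) : ℝ) * t ^ p.2) := by
  rw [PowerSeries.coeff_mul, Int.cast_sum, Finset.sum_mul]
  refine Finset.sum_congr rfl fun p hp => ?_
  rw [← Finset.HasAntidiagonal.mem_antidiagonal.1 hp, pow_add]
  push_cast
  ring

theorem AbsConvergesAt.mul {t : ℝ} {F G : PowerSeries ℤ} (hF : AbsConvergesAt t F)
    (hG : AbsConvergesAt t G) : AbsConvergesAt t (F * G) := by
  unfold AbsConvergesAt
  simp_rw [coeff_mul_mul_pow]
  exact summable_norm_sum_mul_antidiagonal_of_summable_norm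
    (f := fun n => ((PowerSeries.coeff n F : ℤ) : ℝ) * t ^ n)
    (g := fun n => ((PowerSeries.coeff n G : ℤ) : ℝ) * t ^ n) hF hG

theorem seriesEval_mul {t : ℝ} {F G : PowerSeries ℤ} (hF : AbsConvergesAt t F)
    (hG : AbsConvergesAt t G) : seriesEval t (F * G) = seriesEval t F * seriesEval t G := by
  unfold seriesEval
  simp_rw [coeff_mul_mul_pow]
  exact (tsum_mul_tsum_eq_tsum_sum_antidiagonal_of_summable_norm
    (f := fun n => ((PowerSeries.coeff n F : ℤ) : ℝ) * t ^ n)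
    (g := fun n => ((PowerSeries.coeff n G : ℤ) : ℝ) * t ^ n) hF hG).symm

theorem absConvergesAt_coe (t : ℝ) (p : Polynomial ℤ) : AbsConvergesAt t p := by
  refine summable_of_ne_finset_zero (s := Finset.range (p.natDegree + 1)) fun n hn => ?_
  rw [Polynomial.coeff_coe, Polynomial.coeff_eq_zero_of_natDegree_lt (by simpa using hn)]
  simp

theorem seriesEval_coe (t : ℝ) (p : Polynomial ℤ) : seriesEval t p = Polynomial.aeval t p := by
  rw [seriesEval, tsum_eq_sum (s := Finset.range (p.natDegree + 1)),
    Polynomial.aeval_eq_sum_range (R := ℤ)]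
  · refine Finset.sum_congr rfl fun n _ => ?_
    rw [Polynomial.coeff_coe, zsmul_eq_mul]
  · intro n hn
    rw [Polynomial.coeff_coe, Polynomial.coeff_eq_zero_of_natDegree_lt (by simpa using hn)]
    simp

theorem one_sub_X_pow_mul_mk {e : ℕ} (he : e ≠ 0) :
    (1 - PowerSeries.X ^ e : PowerSeries ℤ) * PowerSeries.mk (fun n => if e ∣ n then 1 else 0) =
      1 := by
  ext n
  rw [sub_mul, one_mul, map_sub, PowerSeries.coeff_X_pow_mul', PowerSeries.coeff_mk,
    PowerSeries.coeff_one]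
  rcases Nat.eq_zero_or_pos n with rfl | hn
  · simp [he]
  · rw [if_neg hn.ne']
    by_cases h : e ≤ n
    · rw [if_pos h, PowerSeries.coeff_mk]
      have : e ∣ n - e ↔ e ∣ n := (Nat.dvd_sub_iff_left h dvd_rfl)
      simp [this]
    · have : ¬ e ∣ n := fun hd => h (Nat.le_of_dvd hn hd)
      simp [h, this]

/-- The inverse of `1 - X ^ e` has coefficients `0` and `1`, so it converges absolutely in the open
unit disc and can be multiplied back. -/
theorem AbsConvergesAt.of_mul_one_sub_X_pow {t : ℝ} (ht : |t| < 1) {e : ℕ} (he : e ≠ 0)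
    {F : PowerSeries ℤ} (hF : AbsConvergesAt t (F * (1 - PowerSeries.X ^ e))) :
    AbsConvergesAt t F := by
  have hgeom : AbsConvergesAt t (PowerSeries.mk (fun n => if e ∣ n then 1 else 0)) := by
    refine Summable.of_nonneg_of_le (fun _ => norm_nonneg _) (fun n => ?_)
      (summable_geometric_of_lt_one (abs_nonneg t) ht)
    rw [PowerSeries.coeff_mk, norm_mul, norm_pow, Real.norm_eq_abs t]
    refine mul_le_of_le_one_left (by positivity) ?_
    split_ifs <;> simp
  have h := hF.mul hgeom
  rwa [mul_assoc, one_sub_X_pow_mul_mk he, mul_one] at h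

theorem AbsConvergesAt.of_mul_prod {t : ℝ} (ht : |t| < 1) (es : List ℕ)
    (hes : ∀ e ∈ es, e ≠ 0) {F : PowerSeries ℤ}
    (hF : AbsConvergesAt t (F * (es.map fun e => 1 - PowerSeries.X ^ e).prod)) :
    AbsConvergesAt t F ∧ seriesEval t (F * (es.map fun e => 1 - PowerSeries.X ^ e).prod) =
      seriesEval t F * (es.map fun e => 1 - t ^ e).prod := by
  induction es generalizing F with
  | nil => exact ⟨by simpa using hF, by simp⟩
  | cons e es ih =>
    rw [List.map_cons, List.prod_cons, ← mul_assoc] at hF ⊢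
    obtain ⟨h1, h2⟩ := ih (fun e he => hes e (List.mem_cons_of_mem _ he)) hF
    have h3 := h1.of_mul_one_sub_X_pow ht (hes e List.mem_cons_self)
    have h4 : (1 - PowerSeries.X ^ e : PowerSeries ℤ) =
        ((1 - Polynomial.X ^ e : Polynomial ℤ) : PowerSeries ℤ) := by simp
    refine ⟨h3, ?_⟩
    rw [h2, h4, seriesEval_mul h3 (absConvergesAt_coe _ _), seriesEval_coe]
    simp [mul_assoc]

theorem eval_neg_one_nonpos_of_mul_prod_eq {E : PowerSeries ℤ} (h0 : PowerSeries.coeff 0 E = 1)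
    (hE : ∀ j, j ≠ 0 → (-1) ^ j * PowerSeries.coeff j E ≤ 0)
    (h2 : 2 ≤ PowerSeries.coeff 3 E - PowerSeries.coeff 2 E)
    {es : List ℕ} (hes : ∀ e ∈ es, e ≠ 0) {g : Polynomial ℤ} {a n : ℕ}
    (h : E * (es.map fun e => 1 - PowerSeries.X ^ e).prod =
      ((g * (1 + Polynomial.X) ^ a * (1 - Polynomial.X) ^ n : Polynomial ℤ) : PowerSeries ℤ)) :
    g.eval (-1) ≤ 0 := by
  have key : ∀ r : ℝ, 0 < r → r < 1 → 1 < 2 * r ^ 3 → Polynomial.aeval (-r) g ≤ 0 := by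
    intro r hr0 hr1 hr
    have ht : |(-r)| < 1 := by rwa [abs_neg, abs_of_pos hr0]
    obtain ⟨hconv, heval⟩ := AbsConvergesAt.of_mul_prod ht es hes
      (h ▸ absConvergesAt_coe (-r) _)
    rw [h, seriesEval_coe] at heval
    have hprod : 0 < (es.map fun e => 1 - (-r) ^ e).prod := by
      refine List.prod_pos fun x hx => ?_
      obtain ⟨e, he, rfl⟩ := List.mem_map.1 hx
      have : |(-r) ^ e| < 1 := by
        rw [abs_pow]
        exact pow_lt_one₀ (abs_nonneg _) ht (hes e he)
      linarith [le_abs_self ((-r) ^ e)]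
    have hneg : seriesEval (-r) E < 0 := by
      -- All terms of positive index are nonpositive at `-r`; those of index `2` and `3` already
      -- outweigh the constant term `1`.
      have hsum := (Summable.of_norm hconv).sum_add_tsum_nat_add 4
      have hterm : ∀ j, j ≠ 0 → ((PowerSeries.coeff j E : ℤ) : ℝ) * (-r) ^ j ≤ 0 := by
        intro j hj
        have h3 : (((-1) ^ j * PowerSeries.coeff j E : ℤ) : ℝ) ≤ 0 := by exact_mod_cast hE j hj
        push_cast at h3
        rw [neg_pow, ← mul_assoc, mul_comm ((PowerSeries.coeff j E : ℤ) : ℝ)]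
        exact mul_nonpos_of_nonpos_of_nonneg h3 (by positivity)
      have htail : ∑' j, ((PowerSeries.coeff (j + 4) E : ℤ) : ℝ) * (-r) ^ (j + 4) ≤ 0 :=
        tsum_nonpos fun j => hterm _ (by omega)
      have h1 := hterm 1 one_ne_zero
      have h2' : (2 : ℝ) ≤ ((PowerSeries.coeff 3 E : ℤ) : ℝ) - ((PowerSeries.coeff 2 E : ℤ) : ℝ) := by exact_mod_cast h2
      have h4 : (0 : ℝ) ≤ -((PowerSeries.coeff 2 E : ℤ) : ℝ) := by
        have := hE 2 two_ne_zero
        have h5 : PowerSeries.coeff 2 E ≤ 0 := by simpa using this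
        have h6 : ((PowerSeries.coeff 2 E : ℤ) : ℝ) ≤ 0 := by exact_mod_cast h5
        linarith
      have h5 : r ^ 3 ≤ r ^ 2 := pow_le_pow_of_le_one hr0.le hr1.le (by norm_num)
      rw [seriesEval, ← hsum]
      simp only [Finset.sum_range_succ, Finset.sum_range_zero, h0]
      -- Replacing `r ^ 2` by the smaller `r ^ 3` in the nonpositive quadratic term leaves `-(coeff
      -- 3 - coeff 2) r ^ 3`.
      have h6 : ((PowerSeries.coeff 2 E : ℤ) : ℝ) * (-r) ^ 2 + ((PowerSeries.coeff 3 E : ℤ) : ℝ) * (-r) ^ 3 ≤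
          -(2 * r ^ 3) := by
        have h7 := mul_le_mul_of_nonneg_left h5 h4
        have h8 := mul_le_mul_of_nonneg_right h2' (pow_pos hr0 3).le
        linarith
      push_cast
      linarith
    have hlt := mul_neg_of_neg_of_pos hneg hprod
    rw [← heval] at hlt
    simp only [map_mul, map_pow, map_add, map_sub, map_one, Polynomial.aeval_X] at hlt
    by_contra hcon
    push Not at hcon
    have h1 : 0 < 1 + -r := by linarith
    have h2 : 0 < 1 - -r := by linarith
    have : 0 < Polynomial.aeval (-r) g * (1 + -r) ^ a * (1 - -r) ^ n := by positivity
    linarith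
  have hcont : Filter.Tendsto (fun r : ℝ => Polynomial.aeval (-r) g) (nhdsWithin 1 (Set.Iio 1))
      (nhds (Polynomial.aeval (-1 : ℝ) g)) := by
    have : Continuous fun r : ℝ => Polynomial.aeval (-r) g :=
      (Polynomial.continuous_aeval g).comp continuous_neg
    exact this.continuousWithinAt
  have hle : Polynomial.aeval (-1 : ℝ) g ≤ 0 := by
    refine le_of_tendsto hcont ?_
    -- Any bound whose cube exceeds `1/2` would do; here `2 · 0.9³ = 1.458 > 1`.
    filter_upwards [Ioo_mem_nhdsLT (show (9 / 10 : ℝ) < 1 by norm_num)] with r hr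
    have h3 : (9 / 10 : ℝ) ^ 3 < r ^ 3 := pow_lt_pow_left₀ hr.1 (by norm_num) (by norm_num)
    exact key r (by linarith [hr.1]) hr.2 (by norm_num at h3; linarith)
  have hcast : Polynomial.aeval (-1 : ℝ) g = ((g.eval (-1) : ℤ) : ℝ) := by
    have := Polynomial.aeval_algebraMap_apply ℝ (-1 : ℤ) g
    simpa [Polynomial.aeval_def] using this
  rw [hcast] at hle
  exact_mod_cast hle

end Evaluation

/-! ### The bound on the ranks and the final assembly. -/

open MinimalGradedFreeResolution in
theorem two_le_rank_one_add_rank_two {k : Type u} [Field k] {Q : Type w} [CommRing Q]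
    [Algebra k Q] {R : Type v} [CommRing R] [Algebra k R] [Nontrivial R]
    {𝒬 : ℕ → Submodule k Q} [GradedAlgebra 𝒬] {𝒜 : ℕ → Submodule k R} [GradedAlgebra 𝒜]
    [Module Q R] (G : MinimalGradedFreeResolution 𝒬 𝒜) (φ : 𝒬 →ₐᵍ[k] 𝒜)
    (hφ : Function.Surjective φ) (hsmul : ∀ (x : Q) (y : R), x • y = φ x * y)
    (hQ : IsGradedCompleteIntersection 𝒬) (hR : ¬ IsGradedCompleteIntersection 𝒜) :
    2 ≤ G.rank 1 + G.rank 2 := by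
  by_contra hlt
  rcases Nat.eq_zero_or_pos (G.rank 1) with h1 | h1
  · exact hR (.of_bijective φ ⟨injective_of_rank_one_eq_zero (G := G)
      (φ := (φ.toAlgHom : Q →+* R)) hφ hsmul h1, hφ⟩ hQ)
  · obtain ⟨e, f, hf, hker, hreg⟩ := exists_ker_eq_span_singleton (G := G)
      (φ := (φ.toAlgHom : Q →+* R)) hφ hsmul (by omega) (by omega)
    exact hR (.of_ker_eq_span_singleton φ hφ hf hker hreg hQ)

open MinimalGradedFreeResolution in
theorem mainTheorem9 {k : Type u} [Field k] {R : Type v} [CommRing R] [Algebra k R]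
    (𝒜 : ℕ → Submodule k R) [GradedAlgebra 𝒜] (hR : IsStandardGraded 𝒜)
    (h : Polynomial ℤ) (hh : IsHPolynomial 𝒜 h)
    (a : ℕ) (g : Polynomial ℤ) (hfac : h = g * (1 + Polynomial.X) ^ a)
    (hg : g.eval (-1) ≠ 0)
    (hKoszul : IsKoszul 𝒜) (hBR : HasBackelinRoosProperty 𝒜)
    (hCI : ¬ IsGradedCompleteIntersection 𝒜) :
    g.eval (-1) < 0 := by
  have := hR.nontrivial
  obtain ⟨d, -, hd⟩ := hh
  obtain ⟨F, hF⟩ := hKoszul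
  obtain ⟨Q, _, _, 𝒬, _, φ, hQ, hQCI, hφ, -, K, L, G, hKLG⟩ := hBR
  have := hQ.nontrivial
  obtain ⟨hfinQ, n, es, hes, hHQ⟩ := exists_gradedHilbertSeries_mul_eq hQ.degree_zero hQCI
  have hfinR : ∀ j, Module.Finite k (𝒜 j) :=
    finite_of_surjective (ψ := φ.toAlgHom) (fun j x hx => φ.map_mem hx) hφ
  -- The Koszul hypothesis passes to the resolution `K` of the Golod property.
  have hH0 : gradedHilbertSeries 𝒜 ≠ 0 := fun h0 => by
    have := F.eulerSeries_mul_gradedHilbertSeries_residueField hR.degree_zero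
    rw [h0, mul_zero] at this
    exact zero_ne_one this
  have hKlin : ∀ i q, K.deg i q = i := deg_eq_of_linear F K hF <| mul_right_cancel₀ hH0 <|
    (F.eulerSeries_mul_gradedHilbertSeries_residueField hR.degree_zero).trans
      (K.eulerSeries_mul_gradedHilbertSeries_residueField hR.degree_zero).symm
  -- The resolution `G` of `R` over `Q` is linear from homological degree `1` on.
  let _ : Module Q R := Module.compHom R (φ.toAlgHom : Q →+* R)
  have hsmul : ∀ (x : Q) (y : R), x • y = (φ.toAlgHom : Q →+* R) x * y := fun _ _ => rfl
  have : IsScalarTower k Q R := ⟨fun c x y => by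
    rw [hsmul, hsmul]
    change φ.toAlgHom (c • x) * y = c • (φ.toAlgHom x * y)
    rw [map_smul, smul_mul_assoc]⟩
  change MinimalGradedFreeResolution 𝒬 𝒜 at G
  have hGlin : ∀ i, i ≠ 0 → ∀ q, G.deg i q = i + 1 := fun i hi q =>
    deg_eq_succ_of_golod (G := G) (φ := (φ.toAlgHom : Q →+* R)) hφ hsmul hKLG hKlin hi q
  have hneg := evalNegHom_eulerSeries (G := G) (φ := (φ.toAlgHom : Q →+* R)) hφ hsmul hGlin
  have hcoeff : ∀ j, (-1) ^ j * PowerSeries.coeff j G.eulerSeries =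
      (if j = 0 then 1 else 0) - if 2 ≤ j then (G.rank (j - 1) : ℤ) else 0 := by
    intro j
    have := congrArg (PowerSeries.coeff j) hneg
    rwa [PowerSeries.evalNegHom, PowerSeries.coeff_rescale, map_sub, PowerSeries.coeff_one,
      shiftedRankSeries, PowerSeries.coeff_mk] at this
  have hEuler : G.eulerSeries * gradedHilbertSeries 𝒬 = gradedHilbertSeries 𝒜 :=
    G.eulerSeries_mul_gradedHilbertSeries (fun i j x hx y hy => by
      rw [hsmul]
      exact SetLike.mul_mem_graded (φ.map_mem hx) hy) hasGradedProjections_self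
  have hrank := two_le_rank_one_add_rank_two G φ hφ hsmul hQCI hCI
  -- The `d` exponents equal to `1` account for the factor `(1 - z)^d` that turns the Hilbert series
  -- of `R` into `h`.
  refine lt_of_le_of_ne (eval_neg_one_nonpos_of_mul_prod_eq (E := G.eulerSeries)
    (es := es ++ List.replicate d 1) (a := a) (n := n) ?_ ?_ ?_ ?_ ?_) hg
  · simpa using hcoeff 0
  · intro j hj
    rw [hcoeff, if_neg hj]
    split_ifs <;> simp
  -- The coefficients of degrees `2` and `3` are `-rank G_1` and `rank G_2`, so their difference is
  -- the sum bounded by `hrank`.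
  · have h2 := hcoeff 2
    have h3 := hcoeff 3
    norm_num at h2 h3
    omega
  · intro e he
    rcases List.mem_append.1 he with he | he
    · exact hes e he
    · rw [List.eq_of_mem_replicate he]
      exact one_ne_zero
  · rw [← hfac, Polynomial.coe_mul, hd, ← hEuler, List.map_append, List.prod_append, ← hHQ]
    simp
    ring
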